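/- **Setting.** Let $K\ge 2$, $d\ge1$ and $N\ge 1$, and let $\Phi=(\varphi_1,\dots,\varphi_K)$ be a unit norm tight frame for $\mathbb R^d$ with frame constant $A=K/d$, i.e. $\|\varphi_k\|_2=1$ for all $k$ and $\sum_k\langle\varphi_k,v\rangle^2=A\|v\|_2^2$ for all $v\in\mathbb R^d$. Let $\mu=\max_{i\ne j}|\langle\varphi_i,\varphi_j\rangle|$ be its coherence. Let $\mathcal D$ be the set of all $\Psi=(\psi_1,\dots,\psi_K)$ with $\psi_k\in\mathbb R^d$, $\|\psi_k\|_2=1$, and let $\mathcal X_1$ be the set of matrices $X\in\mathbb R^{K\times N}$ whose columns have at most one nonzero entry each. Let $\nu$ be a probability measure on the unit sphere $S^{K-1}\subset\mathbb R^K$ that is symmetric, i.e. invariant under all changes of signs and all permutations of the coordinates. For $x\in\mathbb R^K$ let $c_1(x)\ge c_2(x)\ge\dots\ge c_K(x)\ge0$ be the non-increasing rearrangement of the absolute values of its entries. Put $\bar c_1^2=\int\|x\|_\infty^2\,d\nu(x)$. Let the signals be $y_n=\Phi x_n+r_n$, $n=1,\dots,N$, where the $x_n$ have law $\nu$, the pairs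 $(x_1,r_1),\dots,(x_N,r_N)$ are independent, $x_n$ and $r_n$ are independent for every $n$, and the $r_n$ are bounded white noise vectors in $\mathbb R^d$: there are constants $\rho,\nu_{\max}$ such that for all $n$, $\|r_n\|_2\le\nu_{\max}$ almost surely, $\mathbb E(r_n)=0$ and $\mathbb E(r_nr_n^\star)=\rho^2I$. Assume that for some $\beta<1/2$ $$\nu\left(\frac{c_2(x)+\mu\|c(x)\|_1+\nu_{\max}}{c_1(x)-c_2(x)}\le\beta\right)=1,$$ where the quotient is read as $+\infty$ if $c_1(x)=c_2(x)$. Put $$\lambda=\bar c_1^2-\frac{1-\bar c_1^2}{K-1},\qquad C_L=(\sqrt A+\nu_{\max})^2 .$$ **Theorem.** If for some $0<q<1/4$ $$N^{-q}+\frac{N^{-2q}}{K}\le\frac{(1-2\beta)^2}{4A\log(4AK/\lambda)},$$ then, except with probability at most $$\exp\left(-\frac{N^{1-4q}\lambda^2}{4K^2C_L}+Kd\log\left(\frac{NKC_L}{\lambda}\right)\right),$$ there is $\tilde\Psi\in\mathcal D$ with $\max_k\|\tilde\psi_k-\varphi_k\|_2\le 2N^{-q}$ such that: 1. $\tilde\Psi$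 is a local maximum on $\mathcal D$ of $\Psi\mapsto\frac1N\sum_{n=1}^N\|\Psi^\star y_n\|_\infty^2=\frac1N\sum_{n=1}^N\max_k\langle\psi_k,y_n\rangle^2$; 2. $\tilde\Psi$ is a local minimum of the K-SVD criterion with $S=1$: with $Y=(y_1,\dots,y_N)$ there is $\tilde X\in\mathcal X_1$ such that $\|Y-\tilde\Psi\tilde X\|_F^2\le\|Y-\Psi X\|_F^2$ for all $\Psi\in\mathcal D$ in a neighbourhood of $\tilde\Psi$ and all $X\in\mathcal X_1$. -/

import Mathlib

open MeasureTheory ProbabilityTheory Filter Topology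

noncomputable section

namespace KSVD

/-- A dictionary: an ordered family of `K` vectors (atoms) in Euclidean `ℝ^d`. -/
abbrev Dict (d K : ℕ) : Type := Fin K → EuclideanSpace ℝ (Fin d)

/-- The set `𝒟` of admissible dictionaries: all atoms have unit norm. -/
def unitDicts (d K : ℕ) : Set (Dict d K) := {Ψ | ∀ k, ‖Ψ k‖ = 1}

/-- `Φ` is a unit norm tight frame for `ℝ^d` with frame constant `A`. -/
structure IsUnitNormTightFrame {d K : ℕ} (Φ : Dict d K) (A : ℝ) : Prop where
  unit_norm : ∀ k, ‖Φ k‖ = 1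
  tight : ∀ v : EuclideanSpace ℝ (Fin d), ∑ k, (inner ℝ (Φ k) v) ^ 2 = A * ‖v‖ ^ 2

/-- The coherence `max_{i ≠ j} |⟨φ_i, φ_j⟩|`. -/
def coherence {d K : ℕ} (Φ : Dict d K) : ℝ :=
  ⨆ p : {p : Fin K × Fin K // p.1 ≠ p.2}, |inner ℝ (Φ p.1.1) (Φ p.1.2)|

/-- The synthesis map `x ↦ Φ x = ∑ k, x k • φ_k`. -/
def synth {d K : ℕ} (Φ : Dict d K) (x : Fin K → ℝ) : EuclideanSpace ℝ (Fin d) :=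
  ∑ k, x k • Φ k

/-- `‖Ψ^* y‖_∞ = max_k |⟨ψ_k, y⟩|` (the norm of `Fin K → ℝ` is the maximum norm). -/
def maxResponse {d K : ℕ} (Ψ : Dict d K) (y : EuclideanSpace ℝ (Fin d)) : ℝ :=
  ‖(fun k => inner ℝ (Ψ k) y : Fin K → ℝ)‖

/-- The empirical criterion for sparsity one, `(1/N) ∑ n, ‖Ψ^* y_n‖_∞ ^ 2`. -/
def maxCriterion {d K N : ℕ} (Y : Fin N → EuclideanSpace ℝ (Fin d)) (Ψ : Dict d K) : ℝ :=
  (1 / (N : ℝ)) * ∑ n, maxResponse Ψ (Y n) ^ 2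

/-- The set `𝒳_S` of coefficient matrices all of whose `N` columns have at most `S`
nonzero entries. -/
def sparseCoeffs (K N S : ℕ) : Set (Fin N → Fin K → ℝ) := {X | ∀ n, hammingNorm (X n) ≤ S}

/-- The K-SVD objective `‖Y - Ψ X‖_F ^ 2`, written as a sum over the columns. -/
def ksvdObjective {d K N : ℕ} (Y : Fin N → EuclideanSpace ℝ (Fin d)) (Ψ : Dict d K)
    (X : Fin N → Fin K → ℝ) : ℝ :=
  ∑ n, ‖Y n - synth Ψ (X n)‖ ^ 2

/-- `Ψ` is a local minimum of the K-SVD criterion `min_{Ψ ∈ 𝒟, X ∈ 𝒳_S} ‖Y - Ψ X‖_F ^ 2`: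
for some `X ∈ 𝒳_S` the value at `(Ψ, X)` is at most the value at `(Ψ', X')` for all `Ψ' ∈ 𝒟`
near `Ψ` and *all* `X' ∈ 𝒳_S`. In particular `X` is optimal for `Ψ`, the pair `(Ψ, X)` is a local
minimum on `𝒟 × 𝒳_S`, and `Ψ` is a local minimum of `Ψ' ↦ min_{X'} ‖Y - Ψ' X'‖_F ^ 2` on `𝒟`. -/
def IsKSVDLocalMin {d K N : ℕ} (S : ℕ) (Y : Fin N → EuclideanSpace ℝ (Fin d))
    (Ψ : Dict d K) : Prop :=
  Ψ ∈ unitDicts d K ∧ ∃ X ∈ sparseCoeffs K N S, ∀ᶠ Ψ' in 𝓝[unitDicts d K] Ψ,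
    ∀ X' ∈ sparseCoeffs K N S, ksvdObjective Y Ψ X ≤ ksvdObjective Y Ψ' X'

/-- Coordinatewise multiplication by a sign sequence. -/
def signChange {K : ℕ} (σ : Fin K → ℤˣ) (x : EuclideanSpace ℝ (Fin K)) :
    EuclideanSpace ℝ (Fin K) :=
  WithLp.toLp 2 fun i => ((σ i : ℤ) : ℝ) * x i

/-- Permutation of the coordinates. -/
def permute {K : ℕ} (p : Equiv.Perm (Fin K)) (x : EuclideanSpace ℝ (Fin K)) :
    EuclideanSpace ℝ (Fin K) :=
  WithLp.toLp 2 fun i => x (p i)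

/-- `ν` is a symmetric probability measure on the unit sphere of `ℝ^K`: it is carried by the
sphere and invariant under all sign changes and all coordinate permutations. -/
structure IsSymmetricOnSphere {K : ℕ} (ν : Measure (EuclideanSpace ℝ (Fin K))) : Prop where
  prob : IsProbabilityMeasure ν
  on_sphere : ∀ᵐ x ∂ν, ‖x‖ = 1
  sign_invariant : ∀ σ : Fin K → ℤˣ, MeasurePreserving (signChange σ) ν ν
  perm_invariant : ∀ p : Equiv.Perm (Fin K), MeasurePreserving (permute p) ν ν

/-- The non-increasing rearrangement of the absolute values of the entries of `x`, with indices
starting at `0` (so the largest value is at index `0`, the second largest at index `1`), extended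
by zero beyond the length of `x`. -/
def decr {K : ℕ} (x : EuclideanSpace ℝ (Fin K)) (j : ℕ) : ℝ :=
  if h : j < K then |x (Tuple.sort (fun i => -|x i|) ⟨j, h⟩)| else 0

/-- The noise-adjusted decay condition: `ν`-almost surely
`(c₁(x) + μ ‖c(x)‖₁ + rmax) / (c₀(x) - c₁(x)) ≤ β`, where `c₀(x) ≥ c₁(x) ≥ ...` is the
non-increasing rearrangement of `|x|`; the quotient counts as infinite if `c₀(x) = c₁(x)`. -/
def NoisyDecay {K : ℕ} (ν : Measure (EuclideanSpace ℝ (Fin K))) (β μ rmax : ℝ) : Prop :=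
  ∀ᵐ x ∂ν, 0 < decr x 0 - decr x 1 ∧
    (decr x 1 + μ * (∑ j ∈ Finset.range K, |decr x j|) + rmax) / (decr x 0 - decr x 1) ≤ β

/-- `𝔼 ‖x‖_∞ ^ 2` for `x` with law `ν`. -/
def meanMaxSq {K : ℕ} (ν : Measure (EuclideanSpace ℝ (Fin K))) : ℝ :=
  ∫ x, ‖(fun i => x i : Fin K → ℝ)‖ ^ 2 ∂ν

/-- `r` is a bounded white noise vector: `‖r‖₂ ≤ rmax` almost surely, `𝔼 r = 0` and
`𝔼 (r r^*) = ρ ^ 2 • I`. -/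
structure IsBoundedWhiteNoise {Ω : Type*} [MeasurableSpace Ω] (P : Measure Ω) {d : ℕ}
    (r : Ω → EuclideanSpace ℝ (Fin d)) (ρ rmax : ℝ) : Prop where
  measurable : Measurable r
  bounded : ∀ᵐ ω ∂P, ‖r ω‖ ≤ rmax
  mean_zero : ∫ ω, r ω ∂P = 0
  white : ∀ i j : Fin d, ∫ ω, r ω i * r ω j ∂P = if i = j then ρ ^ 2 else 0

end KSVD

end

/-!
Write `η = N ^ (-q)` and measure the distance of dictionaries by the largest distance of
corresponding atoms. It is enough to show that, with high probability, no admissible dictionary at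
distance exactly `η` from `Φ` has a larger empirical criterion than `Φ`: the maximum over the
compact `η`-neighbourhood of `Φ` is then attained in its interior
(`exists_isLocalMaxOn_of_boundary`). A local maximum of the maximal response criterion is a local
minimum of the K-SVD criterion because the best one-sparse approximation of `y` leaves the residual
`‖y‖² - ‖Ψ^* y‖_∞²` (`isKSVDLocalMin_of_isLocalMaxOn`).

In expectation, the boundary loses. By the decay condition almost every coefficient vector has a
strictly largest entry, and `Φ` responds maximally at that position `i`. So does a perturbation `Ψ`
unless some `⟨ψ_k - φ_k, Φ x⟩` is large compared with `‖x‖_∞` (`maxResponse_eq_of_decay`). These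
inner products are Rademacher sums of variance at most `A η² ‖x‖_∞²` by sign invariance and
tightness, so this bad event is exponentially unlikely in `1 / η²`
(`IsSymmetricOnSphere.measureReal_badSet_le`). Off the bad event `⟨ψ_i, y⟩²` has to be compared with
`⟨φ_i, y⟩²`. Symmetry makes distinct coefficients uncorrelated given `i`, the noise is white, and
the tight frame identity reduces the mean difference to `-(λ / K) ∑ k, (1 - ⟨ψ_k, φ_k⟩²)`
(`IsSignalModel.integral_indicator_mul_sub`), which is at most `-(λ / K) (η² - η⁴ / 4)` on the
boundary. The sample condition makes the cost of the bad event a fraction of this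
(`bad_event_cost_le`).

Hoeffding's inequality is applied to the differences `‖Ψ^* y_n‖_∞² - ‖Φ^* y_n‖_∞²`. They are bounded
by `2 η C_L` rather than just `C_L`, which gives a better exponent than required; the surplus
absorbs the constants. A net of the boundary, whose size is bounded by comparing volumes in
dimension `K d`, and the Lipschitz bound on the response make the estimate uniform
(`measure_not_exists_isLocalMaxOn_le`).
-/

namespace KSVD

section

/-! ### Tight frames and coherence -/

variable {d K N : ℕ}

lemma inner_synth (Φ : Dict d K) (v : EuclideanSpace ℝ (Fin d)) (x : Fin K → ℝ) :
    inner ℝ v (synth Φ x) = ∑ k, x k * inner ℝ v (Φ k) := by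
  simp [synth, inner_sum, inner_smul_right]

lemma IsUnitNormTightFrame.sum_inner_sq {Φ : Dict d K} {A : ℝ} (h : IsUnitNormTightFrame Φ A)
    (v : EuclideanSpace ℝ (Fin d)) : ∑ k, (inner ℝ v (Φ k)) ^ 2 = A * ‖v‖ ^ 2 := by
  rw [← h.tight v]
  exact Finset.sum_congr rfl fun k _ => by rw [real_inner_comm]

lemma IsUnitNormTightFrame.one_le {Φ : Dict d K} {A : ℝ} (h : IsUnitNormTightFrame Φ A)
    (hK : 0 < K) : 1 ≤ A := by
  have h1 := h.tight (Φ ⟨0, hK⟩)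
  have h2 := Finset.single_le_sum (f := fun k => (inner ℝ (Φ k) (Φ ⟨0, hK⟩)) ^ 2)
    (fun k _ => sq_nonneg _) (Finset.mem_univ ⟨0, hK⟩)
  simp only [real_inner_self_eq_norm_sq, h.unit_norm] at h1 h2
  rw [h1] at h2
  simpa using h2

/-- The synthesis operator of a tight frame with constant `A` has norm at most `√A`, being the
adjoint of the analysis operator. -/
lemma IsUnitNormTightFrame.norm_synth_sq_le {Φ : Dict d K} {A : ℝ} (h : IsUnitNormTightFrame Φ A)
    (x : Fin K → ℝ) : ‖synth Φ x‖ ^ 2 ≤ A * ∑ k, x k ^ 2 := by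
  set s := synth Φ x
  have h1 : ‖s‖ ^ 2 = ∑ k, x k * inner ℝ s (Φ k) := by
    rw [← real_inner_self_eq_norm_sq]
    exact inner_synth Φ s x
  have h2 := Finset.sum_mul_sq_le_sq_mul_sq Finset.univ x (fun k => inner ℝ s (Φ k))
  rw [← h1, h.sum_inner_sq] at h2
  rcases (sq_nonneg ‖s‖).eq_or_lt with h0 | h0
  · rw [← h0] at h2 ⊢
    rcases Nat.eq_zero_or_pos K with rfl | hK
    · simp
    · have := h.one_le hK
      positivity
  · nlinarith

lemma abs_inner_le_coherence (Φ : Dict d K) {i j : Fin K} (hij : i ≠ j) :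
    |inner ℝ (Φ i) (Φ j)| ≤ coherence Φ :=
  le_ciSup (f := fun p : {p : Fin K × Fin K // p.1 ≠ p.2} => |inner ℝ (Φ p.1.1) (Φ p.1.2)|)
    (Set.finite_range _).bddAbove ⟨(i, j), hij⟩

lemma coherence_nonneg (Φ : Dict d K) : 0 ≤ coherence Φ :=
  Real.iSup_nonneg fun _ => abs_nonneg _

/-- For a unit norm dictionary, each atom sees its own coefficient up to an interference of at most
coherence times the `ℓ¹`-norm. -/
lemma abs_inner_synth_sub_le {Φ : Dict d K} (hΦ : ∀ k, ‖Φ k‖ = 1) (x : Fin K → ℝ) (i : Fin K) :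
    |inner ℝ (Φ i) (synth Φ x) - x i| ≤ coherence Φ * ∑ k, |x k| := by
  have h1 : inner ℝ (Φ i) (synth Φ x) - x i
      = ∑ k ∈ Finset.univ.erase i, x k * inner ℝ (Φ i) (Φ k) := by
    rw [inner_synth, ← Finset.add_sum_erase _ _ (Finset.mem_univ i), real_inner_self_eq_norm_sq,
      hΦ i]
    ring
  rw [h1, Finset.mul_sum]
  calc |∑ k ∈ Finset.univ.erase i, x k * inner ℝ (Φ i) (Φ k)|
      ≤ ∑ k ∈ Finset.univ.erase i, |x k * inner ℝ (Φ i) (Φ k)| := Finset.abs_sum_le_sum_abs _ _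
    _ ≤ ∑ k ∈ Finset.univ.erase i, coherence Φ * |x k| := by
        refine Finset.sum_le_sum fun k hk => ?_
        rw [abs_mul, mul_comm]
        exact mul_le_mul_of_nonneg_right
          (abs_inner_le_coherence Φ (Finset.ne_of_mem_erase hk).symm) (abs_nonneg _)
    _ ≤ ∑ k, coherence Φ * |x k| :=
        Finset.sum_le_sum_of_subset_of_nonneg (Finset.erase_subset _ _)
          fun k _ _ => mul_nonneg (coherence_nonneg Φ) (abs_nonneg _)

/-! ### The maximal response -/

lemma maxResponse_nonneg (Ψ : Dict d K) (y : EuclideanSpace ℝ (Fin d)) : 0 ≤ maxResponse Ψ y :=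
  norm_nonneg _

lemma abs_inner_le_maxResponse (Ψ : Dict d K) (y : EuclideanSpace ℝ (Fin d)) (k : Fin K) :
    |inner ℝ (Ψ k) y| ≤ maxResponse Ψ y :=
  norm_le_pi_norm (fun k => inner ℝ (Ψ k) y : Fin K → ℝ) k

lemma inner_sq_le_maxResponse_sq (Ψ : Dict d K) (y : EuclideanSpace ℝ (Fin d)) (k : Fin K) :
    inner ℝ (Ψ k) y ^ 2 ≤ maxResponse Ψ y ^ 2 :=
  sq_le_sq' (abs_le.mp (abs_inner_le_maxResponse Ψ y k)).1
    (abs_le.mp (abs_inner_le_maxResponse Ψ y k)).2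

lemma maxResponse_le {Ψ : Dict d K} {y : EuclideanSpace ℝ (Fin d)} {b : ℝ} (hb : 0 ≤ b)
    (h : ∀ k, |inner ℝ (Ψ k) y| ≤ b) : maxResponse Ψ y ≤ b :=
  (pi_norm_le_iff_of_nonneg hb).mpr h

lemma abs_inner_le_norm {Ψ : Dict d K} (hΨ : Ψ ∈ unitDicts d K) (y : EuclideanSpace ℝ (Fin d))
    (k : Fin K) : |inner ℝ (Ψ k) y| ≤ ‖y‖ := by
  simpa [hΨ k] using abs_real_inner_le_norm (Ψ k) y

lemma maxResponse_le_norm {Ψ : Dict d K} (hΨ : Ψ ∈ unitDicts d K)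
    (y : EuclideanSpace ℝ (Fin d)) : maxResponse Ψ y ≤ ‖y‖ :=
  maxResponse_le (norm_nonneg _) (abs_inner_le_norm hΨ y)

lemma exists_maxResponse_eq (hK : 0 < K) (Ψ : Dict d K) (y : EuclideanSpace ℝ (Fin d)) :
    ∃ k, maxResponse Ψ y = |inner ℝ (Ψ k) y| := by
  have : Nonempty (Fin K) := ⟨⟨0, hK⟩⟩
  obtain ⟨k, hk⟩ := Finite.exists_max fun k => |inner ℝ (Ψ k) y|
  exact ⟨k, le_antisymm (maxResponse_le (abs_nonneg _) hk) (abs_inner_le_maxResponse Ψ y k)⟩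

/-- The maximal response is Lipschitz in the dictionary, for the supremum distance on atoms. -/
lemma abs_maxResponse_sub_le (Ψ Ψ' : Dict d K) (y : EuclideanSpace ℝ (Fin d)) :
    |maxResponse Ψ y - maxResponse Ψ' y| ≤ ‖Ψ - Ψ'‖ * ‖y‖ := by
  refine (abs_norm_sub_norm_le _ _).trans ?_
  refine (pi_norm_le_iff_of_nonneg (by positivity)).mpr fun k => ?_
  rw [Pi.sub_apply, ← inner_sub_left]
  refine (abs_real_inner_le_norm _ _).trans ?_
  gcongr
  exact norm_le_pi_norm (Ψ - Ψ') k

lemma abs_maxResponse_sq_sub_le {Ψ Ψ' : Dict d K} (hΨ : Ψ ∈ unitDicts d K)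
    (hΨ' : Ψ' ∈ unitDicts d K) (y : EuclideanSpace ℝ (Fin d)) :
    |maxResponse Ψ y ^ 2 - maxResponse Ψ' y ^ 2| ≤ 2 * ‖Ψ - Ψ'‖ * ‖y‖ ^ 2 := by
  have h1 := abs_maxResponse_sub_le Ψ Ψ' y
  have h2 := maxResponse_le_norm hΨ y
  have h3 := maxResponse_le_norm hΨ' y
  have h4 := maxResponse_nonneg Ψ y
  have h5 := maxResponse_nonneg Ψ' y
  rw [sq_sub_sq, abs_mul, abs_of_nonneg (add_nonneg h4 h5)]
  calc (maxResponse Ψ y + maxResponse Ψ' y) * |maxResponse Ψ y - maxResponse Ψ' y|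
      ≤ (‖y‖ + ‖y‖) * (‖Ψ - Ψ'‖ * ‖y‖) := by gcongr
    _ = 2 * ‖Ψ - Ψ'‖ * ‖y‖ ^ 2 := by ring

@[fun_prop]
lemma continuous_maxResponse_left (y : EuclideanSpace ℝ (Fin d)) :
    Continuous fun Ψ : Dict d K => maxResponse Ψ y := by
  unfold maxResponse
  fun_prop

@[fun_prop]
lemma continuous_maxResponse_right (Ψ : Dict d K) : Continuous (maxResponse Ψ) := by
  unfold maxResponse
  fun_prop

@[fun_prop]
lemma continuous_maxCriterion (Y : Fin N → EuclideanSpace ℝ (Fin d)) :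
    Continuous (maxCriterion (K := K) Y) := by
  unfold maxCriterion
  fun_prop

/-! ### Equivalence with the K-SVD criterion for sparsity one -/

lemma exists_eq_single_of_hammingNorm_le_one (hK : 0 < K) {x : Fin K → ℝ}
    (hx : hammingNorm x ≤ 1) : ∃ k, x = Pi.single k (x k) := by
  rw [hammingNorm, Finset.card_le_one] at hx
  by_cases h : ∃ k, x k ≠ 0
  · obtain ⟨k, hk⟩ := h
    refine ⟨k, funext fun j => ?_⟩
    by_cases hj : j = k
    · subst hj; simp
    · rw [Pi.single_eq_of_ne hj]
      by_contra h0
      exact hj (hx j (by simpa using h0) k (by simpa using hk))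
  · push Not at h
    exact ⟨⟨0, hK⟩, funext fun j => by simp [h]⟩

lemma synth_single (Ψ : Dict d K) (k : Fin K) (a : ℝ) : synth Ψ (Pi.single k a) = a • Ψ k := by
  simp [synth, Pi.single_apply]

lemma norm_sub_smul_sq {ψ : EuclideanSpace ℝ (Fin d)} (hψ : ‖ψ‖ = 1)
    (y : EuclideanSpace ℝ (Fin d)) (a : ℝ) :
    ‖y - a • ψ‖ ^ 2 = ‖y‖ ^ 2 - inner ℝ ψ y ^ 2 + (a - inner ℝ ψ y) ^ 2 := by
  rw [norm_sub_sq_real, inner_smul_right, norm_smul, hψ, real_inner_comm]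
  rw [Real.norm_eq_abs, mul_one, sq_abs]
  ring

/-- No one-sparse coefficients approximate better than `‖y‖² - ‖Ψ^* y‖_∞²`. -/
lemma sub_maxResponse_sq_le (hK : 0 < K) {Ψ : Dict d K} (hΨ : Ψ ∈ unitDicts d K)
    (y : EuclideanSpace ℝ (Fin d)) {x : Fin K → ℝ} (hx : hammingNorm x ≤ 1) :
    ‖y‖ ^ 2 - maxResponse Ψ y ^ 2 ≤ ‖y - synth Ψ x‖ ^ 2 := by
  obtain ⟨k, hk⟩ := exists_eq_single_of_hammingNorm_le_one hK hx
  rw [hk, synth_single, norm_sub_smul_sq (hΨ k)]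
  linarith [inner_sq_le_maxResponse_sq Ψ y k, sq_nonneg (x k - inner ℝ (Ψ k) y)]

lemma exists_norm_sub_synth_sq_eq (hK : 0 < K) {Ψ : Dict d K} (hΨ : Ψ ∈ unitDicts d K)
    (y : EuclideanSpace ℝ (Fin d)) :
    ∃ x : Fin K → ℝ, hammingNorm x ≤ 1 ∧
      ‖y - synth Ψ x‖ ^ 2 = ‖y‖ ^ 2 - maxResponse Ψ y ^ 2 := by
  obtain ⟨k, hk⟩ := exists_maxResponse_eq hK Ψ y
  refine ⟨Pi.single k (inner ℝ (Ψ k) y), ?_, ?_⟩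
  · rw [hammingNorm, Finset.card_le_one]
    have h : ∀ a : Fin K, Pi.single (M := fun _ => ℝ) k (inner ℝ (Ψ k) y) a ≠ 0 → a = k := by
      intro a ha
      by_contra hak
      exact ha (Pi.single_eq_of_ne hak _)
    intro a ha b hb
    rw [h a (by simpa using ha), h b (by simpa using hb)]
  · rw [synth_single, norm_sub_smul_sq (hΨ k), hk, sq_abs]
    ring

/-- With sparsity one, minimising over the coefficients turns the K-SVD objective into
`‖Y‖_F² - N · maxCriterion`, so local maxima of the latter are local minima of the former. -/
lemma isKSVDLocalMin_of_isLocalMaxOn (hK : 0 < K) (hN : 0 < N)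
    {Y : Fin N → EuclideanSpace ℝ (Fin d)} {Ψ : Dict d K} (hΨ : Ψ ∈ unitDicts d K)
    (h : IsLocalMaxOn (maxCriterion Y) (unitDicts d K) Ψ) : IsKSVDLocalMin 1 Y Ψ := by
  choose X hX hXeq using fun n => exists_norm_sub_synth_sq_eq hK hΨ (Y n)
  refine ⟨hΨ, X, hX, ?_⟩
  filter_upwards [h, self_mem_nhdsWithin] with Ψ' hle hΨ' X' hX'
  have hN' : (0 : ℝ) < 1 / N := by positivity
  have hsum : ∑ n, maxResponse Ψ' (Y n) ^ 2 ≤ ∑ n, maxResponse Ψ (Y n) ^ 2 :=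
    le_of_mul_le_mul_left hle hN'
  calc ksvdObjective Y Ψ X = ∑ n, ‖Y n‖ ^ 2 - ∑ n, maxResponse Ψ (Y n) ^ 2 := by
        rw [ksvdObjective, ← Finset.sum_sub_distrib]
        exact Finset.sum_congr rfl fun n _ => hXeq n
    _ ≤ ∑ n, ‖Y n‖ ^ 2 - ∑ n, maxResponse Ψ' (Y n) ^ 2 := by linarith
    _ ≤ ksvdObjective Y Ψ' X' := by
        rw [ksvdObjective, ← Finset.sum_sub_distrib]
        exact Finset.sum_le_sum fun n _ => sub_maxResponse_sq_le hK hΨ' (Y n) (hX' n)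

/-! ### From the boundary of a neighbourhood to a local maximum -/

lemma isClosed_unitDicts : IsClosed (unitDicts d K) := by
  simp only [unitDicts, Set.ofPred_forall]
  exact isClosed_iInter fun k => isClosed_eq (by fun_prop) continuous_const

/-- If no dictionary at distance exactly `η` from `Φ` beats `Φ`, then there is a local maximum
within distance `η` of `Φ`: a maximum over the compact `η`-neighbourhood, which can be chosen off
the boundary. -/
lemma exists_isLocalMaxOn_of_boundary {F : Dict d K → ℝ} (hF : Continuous F) {Φ : Dict d K}
    (hΦ : Φ ∈ unitDicts d K) {η : ℝ} (hη : 0 < η)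
    (hbd : ∀ Ψ ∈ unitDicts d K, ‖Ψ - Φ‖ = η → F Ψ ≤ F Φ) :
    ∃ Ψ ∈ unitDicts d K, IsLocalMaxOn F (unitDicts d K) Ψ ∧ ‖Ψ - Φ‖ ≤ η := by
  have hcomp : IsCompact (unitDicts d K ∩ Metric.closedBall Φ η) :=
    (isCompact_closedBall Φ η).inter_left isClosed_unitDicts
  obtain ⟨Ψ₀, ⟨h0, h0η⟩, hmax⟩ := hcomp.exists_isMaxOn ⟨Φ, hΦ, Metric.mem_closedBall_self hη.le⟩
    hF.continuousOn
  obtain ⟨Ψ, hΨ, hlt, hmaxΨ⟩ : ∃ Ψ ∈ unitDicts d K, ‖Ψ - Φ‖ < η ∧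
      ∀ Ψ' ∈ unitDicts d K ∩ Metric.closedBall Φ η, F Ψ' ≤ F Ψ := by
    rw [mem_closedBall_iff_norm] at h0η
    rcases h0η.lt_or_eq with hlt | heq
    · exact ⟨Ψ₀, h0, hlt, hmax⟩
    · exact ⟨Φ, hΦ, by simpa using hη, fun Ψ' h' => (hmax h').trans (hbd Ψ₀ h0 heq)⟩
  refine ⟨Ψ, hΨ, ?_, hlt.le⟩
  have hnear : ∀ᶠ Ψ' in 𝓝 Ψ, ‖Ψ' - Φ‖ < η :=
    (continuous_id.sub continuous_const).norm.continuousAt.eventually_lt_const hlt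
  filter_upwards [mem_nhdsWithin_of_mem_nhds hnear, self_mem_nhdsWithin] with Ψ' h1 h2
  exact hmaxΨ Ψ' ⟨h2, mem_closedBall_iff_norm.mpr (le_of_lt h1)⟩

end

section

/-! ### Coefficient vectors with a dominant entry -/

variable {d K N : ℕ}

/-- The vectors whose `i`-th entry is strictly largest in absolute value. -/
def peakSet (i : Fin K) : Set (EuclideanSpace ℝ (Fin K)) := {x | ∀ j, j ≠ i → |x j| < |x i|}

/-- The maximum norm of a vector of Euclidean space. -/
def maxNorm (x : EuclideanSpace ℝ (Fin K)) : ℝ := ‖(fun i => x i : Fin K → ℝ)‖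

lemma abs_le_maxNorm (x : EuclideanSpace ℝ (Fin K)) (i : Fin K) : |x i| ≤ maxNorm x :=
  norm_le_pi_norm (fun i => x i : Fin K → ℝ) i

lemma maxNorm_nonneg (x : EuclideanSpace ℝ (Fin K)) : 0 ≤ maxNorm x := norm_nonneg _

lemma maxNorm_le_norm (x : EuclideanSpace ℝ (Fin K)) : maxNorm x ≤ ‖x‖ :=
  (pi_norm_le_iff_of_nonneg (norm_nonneg _)).mpr fun i => PiLp.norm_apply_le x i

@[fun_prop]
lemma continuous_maxNorm : Continuous (maxNorm (K := K)) := by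
  unfold maxNorm
  fun_prop

lemma maxNorm_eq_of_mem_peakSet {i : Fin K} {x : EuclideanSpace ℝ (Fin K)} (hx : x ∈ peakSet i) :
    maxNorm x = |x i| := by
  refine le_antisymm ((pi_norm_le_iff_of_nonneg (abs_nonneg _)).mpr fun j => ?_)
    (abs_le_maxNorm x i)
  rcases eq_or_ne j i with rfl | hj
  · exact le_rfl
  · exact (hx j hj).le

lemma eq_of_mem_peakSet {i j : Fin K} {x : EuclideanSpace ℝ (Fin K)} (hi : x ∈ peakSet i)
    (hj : x ∈ peakSet j) : i = j := by
  by_contra h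
  exact lt_asymm (hi j (Ne.symm h)) (hj i h)

lemma measurableSet_peakSet (i : Fin K) : MeasurableSet (peakSet i) := by
  simp only [peakSet, Set.ofPred_forall]
  refine MeasurableSet.iInter fun j => MeasurableSet.iInter fun _ => measurableSet_lt ?_ ?_ <;>
    fun_prop

/-- Over the sets of vectors with a peak, the indicator functions pick out the single summand
belonging to the peak. -/
lemma sum_indicator_peakSet {i : Fin K} {x : EuclideanSpace ℝ (Fin K)} (hx : x ∈ peakSet i)
    (f : Fin K → ℝ) : ∑ k, (peakSet k).indicator (fun _ => 1) x * f k = f i := by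
  rw [Finset.sum_eq_single i]
  · simp [hx]
  · intro k _ hk
    rw [Set.indicator_of_notMem (fun h => hk (eq_of_mem_peakSet h hx)), zero_mul]
  · simp

lemma exists_decr_zero_eq (hK : 2 ≤ K) (x : EuclideanSpace ℝ (Fin K)) :
    ∃ i, decr x 0 = |x i| ∧ ∀ j, j ≠ i → |x j| ≤ decr x 1 := by
  set s := Tuple.sort (fun i => -|x i|) with hs
  have hmono : Monotone ((fun i => -|x i|) ∘ s) := Tuple.monotone_sort _
  refine ⟨s ⟨0, by omega⟩, by simp [decr, show 0 < K by omega, hs], fun j hj => ?_⟩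
  have h1 : decr x 1 = |x (s ⟨1, by omega⟩)| := by simp [decr, show 1 < K by omega, hs]
  have hm : (⟨1, by omega⟩ : Fin K) ≤ s.symm j := by
    rw [Fin.le_def]
    by_contra hlt
    refine hj ?_
    rw [← Equiv.symm_apply_eq]
    exact Fin.ext (by simpa using hlt)
  have := hmono hm
  simp only [Function.comp, Equiv.apply_symm_apply] at this
  rw [h1]
  linarith

lemma decr_nonneg (x : EuclideanSpace ℝ (Fin K)) (j : ℕ) : 0 ≤ decr x j := by
  unfold decr
  split_ifs
  · exact abs_nonneg _
  · exact le_rfl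

lemma sum_abs_decr (x : EuclideanSpace ℝ (Fin K)) :
    ∑ j ∈ Finset.range K, |decr x j| = ∑ i, |x i| := by
  rw [Finset.sum_range, ← Equiv.sum_comp (Tuple.sort fun i => -|x i|) fun i => |x i|]
  exact Finset.sum_congr rfl fun i _ => by simp [decr]

/-- Pointwise form of the decay condition: `x` has a peak at `i`, and with `c` a bound for all other
entries the coherence and noise terms are controlled by the gap `|x i| - c`. -/
lemma exists_peak_of_decay (hK : 2 ≤ K) {β μ rmax : ℝ} {x : EuclideanSpace ℝ (Fin K)}
    (hpos : 0 < decr x 0 - decr x 1)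
    (hle : (decr x 1 + μ * (∑ j ∈ Finset.range K, |decr x j|) + rmax) / (decr x 0 - decr x 1)
      ≤ β) :
    ∃ i, x ∈ peakSet i ∧ ∃ c, 0 ≤ c ∧ c < |x i| ∧ (∀ j, j ≠ i → |x j| ≤ c) ∧
      c + μ * ∑ j, |x j| + rmax ≤ β * (|x i| - c) := by
  obtain ⟨i, h0, h1⟩ := exists_decr_zero_eq hK x
  rw [div_le_iff₀ hpos, sum_abs_decr, h0] at hle
  rw [h0, sub_pos] at hpos
  exact ⟨i, fun j hj => (h1 j hj).trans_lt hpos, decr x 1, decr_nonneg _ _, hpos, h1, hle⟩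

/-- If the atoms of `Ψ` deviate little from those of `Φ` as seen by the signal, then `Ψ` also
responds maximally at the peak of the coefficients. The interference and the noise at the peak and
at a competitor cost at most `2 (μ ‖x‖₁ + rmax) ≤ 2 β (|x i| - c) - 2 c`, the perturbations at most
`(1 - 2 β) |x i|`. -/
lemma maxResponse_eq_of_decay {Φ Ψ : Dict d K} (hΦ : ∀ k, ‖Φ k‖ = 1) (hΨ : Ψ ∈ unitDicts d K)
    {β rmax c : ℝ} (hβ : 0 ≤ β) {x : EuclideanSpace ℝ (Fin K)} {i : Fin K} (hc : 0 ≤ c)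
    (hxc : ∀ j, j ≠ i → |x j| ≤ c)
    (hdecay : c + coherence Φ * ∑ j, |x j| + rmax ≤ β * (|x i| - c))
    (r : EuclideanSpace ℝ (Fin d)) (hr : ‖r‖ ≤ rmax)
    (hgood : ∀ k, |inner ℝ (Ψ k - Φ k) (synth Φ fun k => x k)| ≤ (1 - 2 * β) / 2 * |x i|) :
    maxResponse Ψ (synth Φ (fun k => x k) + r) = |inner ℝ (Ψ i) (synth Φ (fun k => x k) + r)| := by
  refine le_antisymm (maxResponse_le (abs_nonneg _) fun k => ?_) (abs_inner_le_maxResponse _ _ i)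
  rcases eq_or_ne k i with rfl | hk
  · exact le_rfl
  have hdev : ∀ k, |inner ℝ (Ψ k) (synth Φ (fun k => x k) + r) - x k|
      ≤ coherence Φ * ∑ j, |x j| + (1 - 2 * β) / 2 * |x i| + rmax := fun k => by
    have e : inner ℝ (Ψ k) (synth Φ (fun k => x k) + r) - x k
        = (inner ℝ (Φ k) (synth Φ fun k => x k) - x k)
          + inner ℝ (Ψ k - Φ k) (synth Φ fun k => x k) + inner ℝ (Ψ k) r := by
      rw [inner_add_right, inner_sub_left]
      ring
    rw [e]
    exact (abs_add_three _ _ _).trans (add_le_add (add_le_add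
      (abs_inner_synth_sub_le hΦ (fun k => x k) k) (hgood k)) ((abs_inner_le_norm hΨ r k).trans hr))
  have h1 := hdev k
  have h2 := hdev i
  have h3 := abs_sub_abs_le_abs_sub (inner ℝ (Ψ k) (synth Φ (fun k => x k) + r)) (x k)
  have h4 := abs_sub_abs_le_abs_sub (x i) (inner ℝ (Ψ i) (synth Φ (fun k => x k) + r))
  rw [abs_sub_comm] at h4
  have h5 := hxc k hk
  nlinarith

end

section

/-! ### Moments of the coefficients given the position of the peak -/

variable {d K N : ℕ}

lemma abs_signChange (σ : Fin K → ℤˣ) (x : EuclideanSpace ℝ (Fin K)) (i : Fin K) :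
    |signChange σ x i| = |x i| := by
  rcases Int.units_eq_one_or (σ i) with h | h <;> simp [signChange, h]

lemma maxNorm_signChange (σ : Fin K → ℤˣ) (x : EuclideanSpace ℝ (Fin K)) :
    maxNorm (signChange σ x) = maxNorm x := by
  have h : ∀ j, ‖signChange σ x j‖₊ = ‖x j‖₊ := fun j => NNReal.eq (abs_signChange σ x j)
  simp only [maxNorm, Pi.norm_def, h]

lemma signChange_preimage_peakSet (σ : Fin K → ℤˣ) (i : Fin K) :
    signChange σ ⁻¹' peakSet i = peakSet i := by
  ext x
  simp [peakSet, abs_signChange]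

lemma permute_preimage_peakSet (p : Equiv.Perm (Fin K)) (i : Fin K) :
    permute p ⁻¹' peakSet i = peakSet (p i) := by
  ext x
  simp only [peakSet, permute, Set.mem_preimage, Set.mem_ofPred_eq]
  refine ⟨fun h j hj => ?_, fun h j hj => h (p j) fun e => hj (p.injective e)⟩
  have := h (p.symm j) fun e => hj (by rw [← e, Equiv.apply_symm_apply])
  rwa [Equiv.apply_symm_apply] at this

/-- The second moment of the `j`-th coefficient on the event that the peak is at `i`. -/
noncomputable def peakMoment (ν : Measure (EuclideanSpace ℝ (Fin K))) (i j : Fin K) : ℝ :=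
  ∫ x in peakSet i, x j ^ 2 ∂ν

variable {ν : Measure (EuclideanSpace ℝ (Fin K))}

lemma IsSymmetricOnSphere.integrable_of_bound (hν : IsSymmetricOnSphere ν)
    {f : EuclideanSpace ℝ (Fin K) → ℝ} (hf : Measurable f) {b : ℝ}
    (hb : ∀ x, ‖x‖ = 1 → |f x| ≤ b) : Integrable f ν := by
  have := hν.prob
  refine Integrable.of_bound hf.aestronglyMeasurable b ?_
  filter_upwards [hν.on_sphere] with x hx using hb x hx

lemma abs_apply_le_one {x : EuclideanSpace ℝ (Fin K)} (hx : ‖x‖ = 1) (i : Fin K) : |x i| ≤ 1 :=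
  hx ▸ PiLp.norm_apply_le x i

lemma IsSymmetricOnSphere.integrable_mul (hν : IsSymmetricOnSphere ν) (j l : Fin K) :
    Integrable (fun x => x j * x l) ν := by
  refine hν.integrable_of_bound (by fun_prop) (b := 1) fun x hx => ?_
  rw [abs_mul]
  exact mul_le_one₀ (abs_apply_le_one hx j) (abs_nonneg _) (abs_apply_le_one hx l)

lemma IsSymmetricOnSphere.integrable_sq (hν : IsSymmetricOnSphere ν) (j : Fin K) :
    Integrable (fun x => x j ^ 2) ν := by
  simpa only [sq] using hν.integrable_mul j j

/-- Flipping one sign shows that distinct coefficients are uncorrelated, also given the position of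
the peak. -/
lemma IsSymmetricOnSphere.setIntegral_mul_eq_zero (hν : IsSymmetricOnSphere ν) (i : Fin K)
    {j l : Fin K} (hjl : j ≠ l) : ∫ x in peakSet i, x j * x l ∂ν = 0 := by
  set σ : Fin K → ℤˣ := Function.update 1 j (-1)
  have h := hν.sign_invariant σ
  have h1 : ∫ x in peakSet i, x j * x l ∂ν
      = ∫ x in peakSet i, signChange σ x j * signChange σ x l ∂ν := by
    conv_lhs => rw [← h.map_eq]
    rw [setIntegral_map (measurableSet_peakSet i)
      (Measurable.aestronglyMeasurable (by fun_prop)) h.measurable.aemeasurable,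
      signChange_preimage_peakSet]
  have h2 : ∀ x, signChange σ x j * signChange σ x l = -(x j * x l) := fun x => by
    simp [signChange, σ, Function.update_of_ne hjl.symm]
  simp only [h2, integral_neg] at h1
  linarith

lemma IsSymmetricOnSphere.peakMoment_perm (hν : IsSymmetricOnSphere ν) (p : Equiv.Perm (Fin K))
    (i j : Fin K) : peakMoment ν (p i) (p j) = peakMoment ν i j := by
  have h := hν.perm_invariant p
  unfold peakMoment
  conv_rhs => rw [← h.map_eq]
  rw [setIntegral_map (measurableSet_peakSet i)
      (Measurable.aestronglyMeasurable (by fun_prop)) h.measurable.aemeasurable,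
      permute_preimage_peakSet]
  rfl

lemma IsSymmetricOnSphere.peakMoment_self_eq (hν : IsSymmetricOnSphere ν) (i i' : Fin K) :
    peakMoment ν i i = peakMoment ν i' i' := by
  simpa using (hν.peakMoment_perm (Equiv.swap i i') i i).symm

lemma IsSymmetricOnSphere.peakMoment_ne_eq (hν : IsSymmetricOnSphere ν) {i j i' j' : Fin K}
    (h : i ≠ j) (h' : i' ≠ j') : peakMoment ν i j = peakMoment ν i' j' := by
  set p := Equiv.swap i i' with hp
  have h1 : p i = i' := by simp [hp]
  have h2 : p j ≠ i' := fun e => h (p.injective (h1.trans e.symm))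
  rw [← hν.peakMoment_perm (p.trans (Equiv.swap (p j) j')) i j]
  simp only [Equiv.trans_apply, h1, Equiv.swap_apply_left]
  rw [Equiv.swap_apply_of_ne_of_ne h2.symm h']

/-- Integrals split over the position of the peak. -/
lemma sum_setIntegral_peakSet (hpeak : ∀ᵐ x ∂ν, ∃ i, x ∈ peakSet i)
    {f : EuclideanSpace ℝ (Fin K) → ℝ} (hf : Integrable f ν) :
    ∑ i, ∫ x in peakSet i, f x ∂ν = ∫ x, f x ∂ν := by
  rw [← integral_iUnion_fintype measurableSet_peakSet _ fun i => hf.integrableOn]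
  · rw [setIntegral_eq_integral_of_ae_compl_eq_zero]
    filter_upwards [hpeak] with x hx hx'
    exact absurd (Set.mem_iUnion.mpr hx) hx'
  · exact fun i j hij => Set.disjoint_left.mpr fun x hi hj => hij (eq_of_mem_peakSet hi hj)

lemma IsSymmetricOnSphere.meanMaxSq_le_one (hν : IsSymmetricOnSphere ν) : meanMaxSq ν ≤ 1 := by
  have := hν.prob
  have hb : ∀ x : EuclideanSpace ℝ (Fin K), ‖x‖ = 1 → maxNorm x ^ 2 ≤ 1 := fun x hx =>
    pow_le_one₀ (maxNorm_nonneg x) (hx ▸ maxNorm_le_norm x)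
  calc meanMaxSq ν ≤ ∫ _, (1 : ℝ) ∂ν := by
        refine integral_mono_ae (hν.integrable_of_bound (f := fun x => maxNorm x ^ 2)
          (by fun_prop) (b := 1) fun x hx => ?_) (integrable_const _) ?_
        · rw [abs_of_nonneg (sq_nonneg _)]
          exact hb x hx
        · filter_upwards [hν.on_sphere] with x hx using hb x hx
    _ = 1 := by simp

lemma IsSymmetricOnSphere.sum_peakMoment_self (hν : IsSymmetricOnSphere ν)
    (hpeak : ∀ᵐ x ∂ν, ∃ i, x ∈ peakSet i) : ∑ i, peakMoment ν i i = meanMaxSq ν := by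
  have hint : Integrable (fun x => maxNorm x ^ 2) ν := by
    refine hν.integrable_of_bound (by fun_prop) (b := 1) fun x hx => ?_
    rw [abs_of_nonneg (sq_nonneg _)]
    exact pow_le_one₀ (maxNorm_nonneg x) (hx ▸ maxNorm_le_norm x)
  refine Eq.trans ?_ (sum_setIntegral_peakSet hpeak hint)
  refine Finset.sum_congr rfl fun i _ => setIntegral_congr_fun (measurableSet_peakSet i) ?_
  intro x hx
  change x i ^ 2 = maxNorm x ^ 2
  rw [maxNorm_eq_of_mem_peakSet hx, sq_abs]

lemma IsSymmetricOnSphere.sum_sum_peakMoment (hν : IsSymmetricOnSphere ν)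
    (hpeak : ∀ᵐ x ∂ν, ∃ i, x ∈ peakSet i) : ∑ i, ∑ j, peakMoment ν i j = 1 := by
  have := hν.prob
  have h1 : ∀ i, ∑ j, peakMoment ν i j = ∫ x in peakSet i, ∑ j, x j ^ 2 ∂ν := fun i =>
    (integral_finsetSum _ fun j _ => (hν.integrable_sq j).integrableOn).symm
  simp only [h1]
  rw [sum_setIntegral_peakSet hpeak
    (integrable_finsetSum _ fun j _ => hν.integrable_sq j)]
  have h2 : ∀ᵐ x ∂ν, ∑ j, x j ^ 2 = 1 := by
    filter_upwards [hν.on_sphere] with x hx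
    rw [← EuclideanSpace.real_norm_sq_eq, hx, one_pow]
  rw [integral_congr_ae h2]
  simp

/-- The gain `λ = 𝔼 ‖x‖_∞² - (1 - 𝔼 ‖x‖_∞²) / (K - 1)`, the difference between the mean square of
the largest coefficient and the average mean square of the others. -/
noncomputable def peakGain (ν : Measure (EuclideanSpace ℝ (Fin K))) : ℝ :=
  meanMaxSq ν - (1 - meanMaxSq ν) / ((K : ℝ) - 1)

lemma IsSymmetricOnSphere.peakMoment_sub_eq (hν : IsSymmetricOnSphere ν)
    (hpeak : ∀ᵐ x ∂ν, ∃ i, x ∈ peakSet i) {i j : Fin K} (hij : i ≠ j) :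
    peakMoment ν i i - peakMoment ν i j = peakGain ν / K := by
  have h1 : (K : ℝ) * peakMoment ν i i = meanMaxSq ν := by
    rw [← hν.sum_peakMoment_self hpeak, Finset.sum_congr rfl fun k _ => hν.peakMoment_self_eq k i]
    simp
  have h2 : (K : ℝ) * (peakMoment ν i i + (K - 1) * peakMoment ν i j) = 1 := by
    have h3 : ∀ k, ∑ l, peakMoment ν k l = peakMoment ν i i + (K - 1) * peakMoment ν i j := by
      intro k
      have h4 : ∀ l ∈ Finset.univ.erase k, peakMoment ν k l = peakMoment ν i j := fun l hl =>
        hν.peakMoment_ne_eq (Finset.ne_of_mem_erase hl).symm hij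
      rw [← Finset.add_sum_erase _ _ (Finset.mem_univ k), hν.peakMoment_self_eq k i,
        Finset.sum_congr rfl h4, Finset.sum_const, Finset.card_erase_of_mem (Finset.mem_univ k),
        Finset.card_univ, Fintype.card_fin, nsmul_eq_mul, Nat.cast_sub (Fin.pos k), Nat.cast_one]
    refine Eq.trans ?_ (hν.sum_sum_peakMoment hpeak)
    rw [Finset.sum_congr rfl fun k _ => h3 k, Finset.sum_const,
      Finset.card_univ, Fintype.card_fin, nsmul_eq_mul]
  have hK : 1 < K := by
    have := i.isLt
    have := j.isLt
    have := Fin.val_ne_of_ne hij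
    omega
  have hK' : (1 : ℝ) < K := by exact_mod_cast hK
  have hK1 : (K : ℝ) - 1 ≠ 0 := by linarith
  have hK0 : (K : ℝ) ≠ 0 := by linarith
  rw [peakGain, ← h1]
  field_simp
  linear_combination (-1) * h2

lemma IsSymmetricOnSphere.peakGain_pos (hν : IsSymmetricOnSphere ν)
    (hpeak : ∀ᵐ x ∂ν, ∃ i, x ∈ peakSet i) (hK : 2 ≤ K) : 0 < peakGain ν := by
  have := hν.prob
  have hK0 : (0 : ℝ) < K := by exact_mod_cast (show 0 < K by omega)
  suffices h : ∃ i j : Fin K, i ≠ j ∧ 0 < peakMoment ν i i - peakMoment ν i j by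
    obtain ⟨i, j, hij, h⟩ := h
    rw [hν.peakMoment_sub_eq hpeak hij] at h
    simpa using (lt_div_iff₀ hK0).mp h
  have hU : ν (⋃ i, peakSet i) ≠ 0 := by
    have h1 : ∀ᵐ x ∂ν, x ∈ ⋃ i, peakSet i := by
      filter_upwards [hpeak] with x hx using Set.mem_iUnion.mpr hx
    intro h0
    have h2 := (measure_eq_zero_iff_ae_notMem.mp h0).and h1
    obtain ⟨x, hx, hx'⟩ := h2.exists
    exact hx hx'
  obtain ⟨i, hi⟩ : ∃ i, ν (peakSet i) ≠ 0 := by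
    by_contra! h
    exact hU (measure_iUnion_null h)
  obtain ⟨j, hj⟩ : ∃ j : Fin K, j ≠ i := by
    have : Nontrivial (Fin K) := Fin.nontrivial_iff_two_le.mpr hK
    exact exists_ne i
  refine ⟨i, j, hj.symm, ?_⟩
  have hlt : ∀ x ∈ peakSet i, 0 < x i ^ 2 - x j ^ 2 := fun x hx => by
    have := sq_lt_sq.mpr (hx j hj)
    linarith
  rw [peakMoment, peakMoment, ← integral_sub (hν.integrable_sq i).integrableOn
    (hν.integrable_sq j).integrableOn, setIntegral_pos_iff_support_of_nonneg_ae]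
  · refine lt_of_lt_of_le (pos_iff_ne_zero.mpr hi) (measure_mono fun x hx => ⟨?_, hx⟩)
    exact (hlt x hx).ne'
  · exact (ae_restrict_iff' (measurableSet_peakSet i)).mpr (ae_of_all _ fun x hx => (hlt x hx).le)
  · exact ((hν.integrable_sq i).sub (hν.integrable_sq j)).integrableOn

lemma IsSymmetricOnSphere.peakGain_le_one (hν : IsSymmetricOnSphere ν) (hK : 2 ≤ K) :
    peakGain ν ≤ 1 := by
  have h1 := hν.meanMaxSq_le_one
  have hK' : (1 : ℝ) < K := by exact_mod_cast (show 1 < K by omega)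
  have : 0 ≤ (1 - meanMaxSq ν) / ((K : ℝ) - 1) := div_nonneg (by linarith) (by linarith)
  rw [peakGain]
  linarith

/-- The energy seen by a vector `v` when the peak is at `i` depends on `v` only through its length
and its correlation with the `i`-th atom; this is where tightness of the frame enters. -/
lemma IsSymmetricOnSphere.setIntegral_inner_synth_sq (hν : IsSymmetricOnSphere ν)
    (hpeak : ∀ᵐ x ∂ν, ∃ i, x ∈ peakSet i) {Φ : Dict d K} {A : ℝ}
    (hΦ : IsUnitNormTightFrame Φ A) {i j : Fin K} (hij : i ≠ j) (v : EuclideanSpace ℝ (Fin d)) :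
    ∫ x in peakSet i, inner ℝ v (synth Φ fun k => x k) ^ 2 ∂ν
      = peakGain ν / K * inner ℝ v (Φ i) ^ 2 + A * ‖v‖ ^ 2 * peakMoment ν i j := by
  have h1 : ∀ x : EuclideanSpace ℝ (Fin K), inner ℝ v (synth Φ fun k => x k) ^ 2
      = ∑ k, ∑ l, inner ℝ v (Φ k) * inner ℝ v (Φ l) * (x k * x l) := fun x => by
    rw [inner_synth, sq, Finset.sum_mul_sum]
    exact Finset.sum_congr rfl fun k _ => Finset.sum_congr rfl fun l _ => by ring
  have hint : ∀ k l, Integrable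
      (fun x : EuclideanSpace ℝ (Fin K) => inner ℝ v (Φ k) * inner ℝ v (Φ l) * (x k * x l))
      (ν.restrict (peakSet i)) := fun k l => ((hν.integrable_mul k l).const_mul _).integrableOn
  simp only [h1]
  rw [integral_finsetSum _ fun k _ => integrable_finsetSum _ fun l _ => hint k l]
  have h2 : ∀ k, ∫ x in peakSet i,
      ∑ l, inner ℝ v (Φ k) * inner ℝ v (Φ l) * (x k * x l) ∂ν
      = inner ℝ v (Φ k) ^ 2 * peakMoment ν i k := fun k => by
    rw [integral_finsetSum _ fun l _ => hint k l, Finset.sum_eq_single k]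
    · rw [integral_const_mul, peakMoment]
      simp only [sq]
    · intro l _ hl
      rw [integral_const_mul, hν.setIntegral_mul_eq_zero i hl.symm, mul_zero]
    · simp
  simp only [h2]
  have h3 : ∀ k ∈ Finset.univ.erase i, inner ℝ v (Φ k) ^ 2 * peakMoment ν i k
      = inner ℝ v (Φ k) ^ 2 * peakMoment ν i j := fun k hk => by
    rw [hν.peakMoment_ne_eq (Finset.ne_of_mem_erase hk).symm hij]
  have h4 := hΦ.sum_inner_sq v
  rw [← Finset.add_sum_erase _ _ (Finset.mem_univ i)] at h4 ⊢
  rw [Finset.sum_congr rfl h3, ← Finset.sum_mul, ← hν.peakMoment_sub_eq hpeak hij]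
  linear_combination peakMoment ν i j * h4

end

section

/-! ### Tail bounds from random signs -/

variable {d K N : ℕ} {ν : Measure (EuclideanSpace ℝ (Fin K))}

/-- Moment generating function of a Rademacher sum, as an unnormalised sum over all signs. -/
lemma sum_exp_sign_le (a : Fin K → ℝ) :
    ∑ σ : Fin K → ℤˣ, Real.exp (∑ j, ((σ j : ℤ) : ℝ) * a j)
      ≤ 2 ^ K * Real.exp ((∑ j, a j ^ 2) / 2) := by
  have h1 : ∑ σ : Fin K → ℤˣ, Real.exp (∑ j, ((σ j : ℤ) : ℝ) * a j)
      = ∏ j, ∑ s : ℤˣ, Real.exp (((s : ℤ) : ℝ) * a j) := by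
    rw [Finset.prod_univ_sum, Fintype.piFinset_univ]
    exact Finset.sum_congr rfl fun σ _ => Real.exp_sum _ _
  have h2 : ∀ b : ℝ, ∑ s : ℤˣ, Real.exp (((s : ℤ) : ℝ) * b) = 2 * Real.cosh b := fun b => by
    rw [UnitsInt.univ, Finset.sum_pair (by decide), Real.cosh_eq]
    simp
    ring
  rw [h1]
  simp only [h2]
  calc ∏ j, (2 * Real.cosh (a j)) ≤ ∏ j, (2 * Real.exp (a j ^ 2 / 2)) :=
        Finset.prod_le_prod (fun j _ => by positivity)
          fun j _ => mul_le_mul_of_nonneg_left (Real.cosh_le_exp_half_sq _) zero_le_two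
    _ = 2 ^ K * Real.exp ((∑ j, a j ^ 2) / 2) := by
        rw [Finset.prod_mul_distrib, ← Real.exp_sum, Finset.sum_div]
        simp

/-- Under a sign-invariant law, linear functionals of the vector normalised by its maximum norm are
sub-Gaussian with the variance of the worst case, all entries having equal modulus. -/
lemma IsSymmetricOnSphere.hasSubgaussianMGF (hν : IsSymmetricOnSphere ν) (v : Fin K → ℝ)
    {c : NNReal} (hc : ∑ j, v j ^ 2 ≤ c) :
    HasSubgaussianMGF (fun x => (∑ j, x j * v j) / maxNorm x) c ν := by
  have := hν.prob
  have hle : ∀ (x : EuclideanSpace ℝ (Fin K)) j, |x j / maxNorm x| ≤ 1 := fun x j => by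
    rw [abs_div, abs_of_nonneg (maxNorm_nonneg x)]
    exact div_le_one_of_le₀ (abs_le_maxNorm x j) (maxNorm_nonneg x)
  have hmeas : Measurable fun x : EuclideanSpace ℝ (Fin K) => (∑ j, x j * v j) / maxNorm x :=
    Measurable.div (by fun_prop) continuous_maxNorm.measurable
  have heq : ∀ x : EuclideanSpace ℝ (Fin K),
      (∑ j, x j * v j) / maxNorm x = ∑ j, x j / maxNorm x * v j := fun x => by
    rw [Finset.sum_div]
    exact Finset.sum_congr rfl fun j _ => by ring
  have hbound : ∀ x : EuclideanSpace ℝ (Fin K), |(∑ j, x j * v j) / maxNorm x| ≤ ∑ j, |v j| :=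
    fun x => by
      rw [heq]
      refine (Finset.abs_sum_le_sum_abs _ _).trans (Finset.sum_le_sum fun j _ => ?_)
      rw [abs_mul]
      exact mul_le_of_le_one_left (abs_nonneg _) (hle x j)
  have hint : ∀ t : ℝ, Integrable
      (fun x : EuclideanSpace ℝ (Fin K) => Real.exp (t * ((∑ j, x j * v j) / maxNorm x))) ν :=
    fun t => by
      refine hν.integrable_of_bound (hmeas.const_mul t).exp
        (b := Real.exp (|t| * ∑ j, |v j|)) fun x _ => ?_
      rw [Real.abs_exp, Real.exp_le_exp]
      refine (le_abs_self _).trans ?_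
      rw [abs_mul]
      exact mul_le_mul_of_nonneg_left (hbound x) (abs_nonneg t)
  refine ⟨hint, fun t => ?_⟩
  set f : EuclideanSpace ℝ (Fin K) → ℝ := fun x => Real.exp (t * ((∑ j, x j * v j) / maxNorm x))
    with hf
  have hfm : Measurable f := (hmeas.const_mul t).exp
  have hflip : ∀ σ, ∫ x, f (signChange σ x) ∂ν = ∫ x, f x ∂ν := fun σ => by
    have h := hν.sign_invariant σ
    conv_rhs => rw [← h.map_eq]
    rw [integral_map h.measurable.aemeasurable hfm.aestronglyMeasurable]
  have hsum : ∀ x, ∑ σ, f (signChange σ x) ≤ 2 ^ K * Real.exp (c * t ^ 2 / 2) := fun x => by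
    have h1 : ∀ σ, f (signChange σ x)
        = Real.exp (∑ j, ((σ j : ℤ) : ℝ) * (t * (x j / maxNorm x * v j))) := fun σ => by
      simp only [hf, maxNorm_signChange, Finset.sum_div, Finset.mul_sum]
      congr 1
      exact Finset.sum_congr rfl fun j _ => by
        simp only [signChange]
        ring
    simp only [h1]
    refine (sum_exp_sign_le _).trans ?_
    gcongr
    calc ∑ j, (t * (x j / maxNorm x * v j)) ^ 2 ≤ ∑ j, v j ^ 2 * t ^ 2 := by
          refine Finset.sum_le_sum fun j _ => ?_
          have h2 : (x j / maxNorm x) ^ 2 ≤ 1 := (sq_le_one_iff_abs_le_one _).mpr (hle x j)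
          have h3 : (t * (x j / maxNorm x * v j)) ^ 2
              = (x j / maxNorm x) ^ 2 * (v j ^ 2 * t ^ 2) := by ring
          rw [h3]
          exact mul_le_of_le_one_left (by positivity) h2
      _ = (∑ j, v j ^ 2) * t ^ 2 := by rw [Finset.sum_mul]
      _ ≤ c * t ^ 2 := by gcongr
  have hflipint : ∀ σ, Integrable (fun x => f (signChange σ x)) ν := fun σ =>
    (hν.sign_invariant σ).integrable_comp_of_integrable (hint t)
  have h4 : (2 : ℝ) ^ K * ∫ x, f x ∂ν ≤ 2 ^ K * Real.exp (c * t ^ 2 / 2) := by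
    calc (2 : ℝ) ^ K * ∫ x, f x ∂ν = ∑ σ : Fin K → ℤˣ, ∫ x, f (signChange σ x) ∂ν := by
          simp [hflip]
      _ = ∫ x, ∑ σ : Fin K → ℤˣ, f (signChange σ x) ∂ν :=
          (integral_finsetSum _ fun σ _ => hflipint σ).symm
      _ ≤ ∫ _, 2 ^ K * Real.exp (c * t ^ 2 / 2) ∂ν :=
          integral_mono (integrable_finsetSum _ fun σ _ => hflipint σ) (integrable_const _) hsum
      _ = 2 ^ K * Real.exp (c * t ^ 2 / 2) := by simp
  exact le_of_mul_le_mul_left h4 (by positivity)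

lemma IsSymmetricOnSphere.measureReal_abs_sum_gt_le (hν : IsSymmetricOnSphere ν) (v : Fin K → ℝ)
    {c : NNReal} (hc : ∑ j, v j ^ 2 ≤ c) {τ : ℝ} (hτ : 0 ≤ τ) :
    ν.real {x | τ * maxNorm x < |∑ j, x j * v j|} ≤ 2 * Real.exp (-τ ^ 2 / (2 * c)) := by
  have := hν.prob
  have h := hν.hasSubgaussianMGF v hc
  have h1 := h.measure_ge_le hτ
  have h2 := h.neg.measure_ge_le hτ
  refine (measureReal_mono (s₂ := {x | τ ≤ (∑ j, x j * v j) / maxNorm x} ∪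
    {x | τ ≤ (-fun x : EuclideanSpace ℝ (Fin K) => (∑ j, x j * v j) / maxNorm x) x}) ?_).trans
    ((measureReal_union_le _ _).trans ?_)
  · intro x hx
    simp only [Set.mem_ofPred_eq] at hx
    have hpos : 0 < maxNorm x := by
      refine (maxNorm_nonneg x).lt_of_ne fun h0 => ?_
      have hz : ∀ j, x j = 0 := fun j =>
        abs_nonpos_iff.mp ((abs_le_maxNorm x j).trans h0.symm.le)
      simp [hz, ← h0] at hx
    rcases lt_abs.mp hx with h | h
    · left
      exact ((lt_div_iff₀ hpos).mpr h).le
    · right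
      simp only [Set.mem_ofPred_eq, Pi.neg_apply, ← neg_div]
      exact ((lt_div_iff₀ hpos).mpr h).le
  · linarith

/-- The coefficients for which, at threshold `τ`, some atom of `Ψ` deviates too much from the
corresponding atom of `Φ` as seen by the noiseless signal. -/
def badSet (Φ Ψ : Dict d K) (τ : ℝ) : Set (EuclideanSpace ℝ (Fin K)) :=
  {x | ∃ k, τ * maxNorm x < |inner ℝ (Ψ k - Φ k) (synth Φ fun j => x j)|}

lemma measurableSet_badSet (Φ Ψ : Dict d K) (τ : ℝ) : MeasurableSet (badSet Φ Ψ τ) := by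
  have h : badSet Φ Ψ τ
      = ⋃ k, {x | τ * maxNorm x < |∑ j, x j * inner ℝ (Ψ k - Φ k) (Φ j)|} := by
    ext x
    simp [badSet, inner_synth]
  rw [h]
  exact MeasurableSet.iUnion fun k =>
    measurableSet_lt (continuous_maxNorm.measurable.const_mul τ) (by fun_prop)

lemma IsSymmetricOnSphere.measureReal_badSet_le (hν : IsSymmetricOnSphere ν) {Φ : Dict d K} {A : ℝ}
    (hΦ : IsUnitNormTightFrame Φ A) (hA : 0 ≤ A) {Ψ : Dict d K} {η : ℝ} (hη : ‖Ψ - Φ‖ ≤ η) {τ : ℝ}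
    (hτ : 0 ≤ τ) :
    ν.real (badSet Φ Ψ τ) ≤ 2 * K * Real.exp (-τ ^ 2 / (2 * (A * η ^ 2))) := by
  have h : badSet Φ Ψ τ
      = ⋃ k, {x | τ * maxNorm x < |∑ j, x j * inner ℝ (Ψ k - Φ k) (Φ j)|} := by
    ext x
    simp [badSet, inner_synth]
  have hk : ∀ k, ν.real {x | τ * maxNorm x < |∑ j, x j * inner ℝ (Ψ k - Φ k) (Φ j)|}
      ≤ 2 * Real.exp (-τ ^ 2 / (2 * (A * η ^ 2))) := fun k => by
    refine hν.measureReal_abs_sum_gt_le _ (c := ⟨A * η ^ 2, by positivity⟩) ?_ hτ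
    rw [hΦ.sum_inner_sq]
    change A * ‖Ψ k - Φ k‖ ^ 2 ≤ A * η ^ 2
    gcongr
    exact (norm_le_pi_norm (Ψ - Φ) k).trans hη
  rw [h]
  calc ν.real (⋃ k, {x | τ * maxNorm x < |∑ j, x j * inner ℝ (Ψ k - Φ k) (Φ j)|})
      ≤ ∑ k, ν.real {x | τ * maxNorm x < |∑ j, x j * inner ℝ (Ψ k - Φ k) (Φ j)|} :=
        measureReal_iUnion_fintype_le _
    _ ≤ ∑ _k : Fin K, 2 * Real.exp (-τ ^ 2 / (2 * (A * η ^ 2))) :=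
        Finset.sum_le_sum fun k _ => hk k
    _ = 2 * K * Real.exp (-τ ^ 2 / (2 * (A * η ^ 2))) := by
        simp
        ring

end

section

/-! ### The expected loss of a perturbed dictionary -/

variable {d K N : ℕ} {Ω : Type*} [MeasurableSpace Ω] {P : Measure Ω}
  {X : Ω → EuclideanSpace ℝ (Fin K)} {R : Ω → EuclideanSpace ℝ (Fin d)} {ρ rmax : ℝ}
  {ν : Measure (EuclideanSpace ℝ (Fin K))}

lemma continuous_synth (Φ : Dict d K) :
    Continuous fun x : EuclideanSpace ℝ (Fin K) => synth Φ fun k => x k := by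
  unfold synth
  fun_prop

lemma norm_synth_le_of_norm_eq_one {Φ : Dict d K} {A : ℝ} (hΦ : IsUnitNormTightFrame Φ A)
    {x : EuclideanSpace ℝ (Fin K)} (hx : ‖x‖ = 1) : ‖synth Φ fun k => x k‖ ≤ √A := by
  refine Real.le_sqrt_of_sq_le ((hΦ.norm_synth_sq_le _).trans_eq ?_)
  rw [← EuclideanSpace.real_norm_sq_eq, hx]
  ring

/-- The model of a single signal `Φ X + R`: the coefficient vector `X` has law `ν` and is
independent of the bounded white noise `R`. -/
structure IsSignalModel (ν : Measure (EuclideanSpace ℝ (Fin K))) (P : Measure Ω)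
    (X : Ω → EuclideanSpace ℝ (Fin K)) (R : Ω → EuclideanSpace ℝ (Fin d)) (ρ rmax : ℝ) :
    Prop where
  measurable : Measurable X
  law : P.map X = ν
  noise : IsBoundedWhiteNoise P R ρ rmax
  indep : IndepFun X R P

lemma IsSignalModel.ae_of_ae (h : IsSignalModel ν P X R ρ rmax)
    {p : EuclideanSpace ℝ (Fin K) → Prop} (hp : ∀ᵐ x ∂ν, p x) : ∀ᵐ ω ∂P, p (X ω) := by
  rw [← h.law] at hp
  exact ae_of_ae_map h.measurable.aemeasurable hp

lemma IsSignalModel.measurable_signal (h : IsSignalModel ν P X R ρ rmax) (Φ : Dict d K) :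
    Measurable fun ω => synth Φ (fun k => X ω k) + R ω :=
  ((continuous_synth Φ).measurable.comp h.measurable).add h.noise.measurable

lemma IsSignalModel.ae_norm_signal_sq_le (h : IsSignalModel ν P X R ρ rmax)
    (hν : IsSymmetricOnSphere ν) {Φ : Dict d K} {A : ℝ} (hΦ : IsUnitNormTightFrame Φ A) :
    ∀ᵐ ω ∂P, ‖synth Φ (fun k => X ω k) + R ω‖ ^ 2 ≤ (√A + rmax) ^ 2 := by
  filter_upwards [h.ae_of_ae hν.on_sphere, h.noise.bounded] with ω h1 h2
  have := (norm_add_le (synth Φ fun k => X ω k) (R ω)).trans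
    (add_le_add (norm_synth_le_of_norm_eq_one hΦ h1) h2)
  gcongr

variable [IsProbabilityMeasure P]

lemma IsBoundedWhiteNoise.rmax_nonneg (h : IsBoundedWhiteNoise P R ρ rmax) : 0 ≤ rmax := by
  obtain ⟨ω, hω⟩ := h.bounded.exists
  exact (norm_nonneg _).trans hω

lemma IsBoundedWhiteNoise.integrable (h : IsBoundedWhiteNoise P R ρ rmax) : Integrable R P :=
  Integrable.of_bound h.measurable.aestronglyMeasurable rmax h.bounded

lemma IsBoundedWhiteNoise.integral_inner_eq_zero (h : IsBoundedWhiteNoise P R ρ rmax)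
    (v : EuclideanSpace ℝ (Fin d)) : ∫ ω, inner ℝ v (R ω) ∂P = 0 := by
  rw [integral_inner h.integrable, h.mean_zero, inner_zero_right]

lemma IsBoundedWhiteNoise.integral_inner_sq (h : IsBoundedWhiteNoise P R ρ rmax)
    (v : EuclideanSpace ℝ (Fin d)) : ∫ ω, inner ℝ v (R ω) ^ 2 ∂P = ρ ^ 2 * ‖v‖ ^ 2 := by
  have hm := h.measurable
  have hint : ∀ i j, Integrable (fun ω => v i * v j * (R ω i * R ω j)) P := fun i j => by
    refine (Integrable.of_bound (Measurable.aestronglyMeasurable (by fun_prop))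
      (rmax * rmax) ?_).const_mul _
    filter_upwards [h.bounded] with ω hω
    rw [norm_mul]
    have := h.rmax_nonneg
    have h1 := (PiLp.norm_apply_le (R ω) i).trans hω
    have h2 := (PiLp.norm_apply_le (R ω) j).trans hω
    gcongr
  have h1 : ∀ ω, inner ℝ v (R ω) ^ 2 = ∑ i, ∑ j, v i * v j * (R ω i * R ω j) := fun ω => by
    rw [PiLp.inner_apply, sq, Finset.sum_mul_sum]
    refine Finset.sum_congr rfl fun i _ => Finset.sum_congr rfl fun j _ => ?_
    simp only [RCLike.inner_apply, conj_trivial]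
    ring
  simp only [h1]
  rw [integral_finsetSum _ fun i _ => integrable_finsetSum _ fun j _ => hint i j]
  simp only [integral_finsetSum _ fun j _ => hint _ j, integral_const_mul, h.white]
  rw [EuclideanSpace.real_norm_sq_eq, Finset.mul_sum]
  refine Finset.sum_congr rfl fun i _ => ?_
  simp
  ring

/-- Mean energy of the signal in direction `v` on the event that the peak is at `i`: the noise
contributes a term depending only on the length of `v`. -/
lemma IsSignalModel.integral_indicator_mul_inner_sq (h : IsSignalModel ν P X R ρ rmax)
    (hν : IsSymmetricOnSphere ν) {Φ : Dict d K} {A : ℝ} (hΦ : IsUnitNormTightFrame Φ A)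
    (i : Fin K) (v : EuclideanSpace ℝ (Fin d)) :
    Integrable (fun ω => (peakSet i).indicator (fun _ => (1 : ℝ)) (X ω) *
      inner ℝ v (synth Φ (fun k => X ω k) + R ω) ^ 2) P ∧
    ∫ ω, (peakSet i).indicator (fun _ => (1 : ℝ)) (X ω) *
      inner ℝ v (synth Φ (fun k => X ω k) + R ω) ^ 2 ∂P
    = ∫ x in peakSet i, inner ℝ v (synth Φ fun k => x k) ^ 2 ∂ν
      + ν.real (peakSet i) * (ρ ^ 2 * ‖v‖ ^ 2) := by
  have := hν.prob
  have hXm := h.measurable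
  have hRm := h.noise.measurable
  have hr0 := h.noise.rmax_nonneg
  set I : EuclideanSpace ℝ (Fin K) → ℝ := (peakSet i).indicator fun _ => 1 with hI
  set s : EuclideanSpace ℝ (Fin K) → ℝ := fun x => inner ℝ v (synth Φ fun k => x k) with hs
  have hIm : Measurable I := measurable_const.indicator (measurableSet_peakSet i)
  have hsm : Measurable s := (continuous_const.inner (continuous_synth Φ)).measurable
  have hIle : ∀ x, |I x| ≤ 1 := fun x => by
    by_cases hx : x ∈ peakSet i <;> simp [hI, hx]
  have hsle : ∀ x, ‖x‖ = 1 → |s x| ≤ ‖v‖ * √A := fun x hx =>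
    (abs_real_inner_le_norm _ _).trans
      (mul_le_mul_of_nonneg_left (norm_synth_le_of_norm_eq_one hΦ hx) (norm_nonneg v))
  -- the three terms of the expanded square
  have hf1 : Integrable (fun x => I x * s x ^ 2) ν :=
    hν.integrable_of_bound (hIm.mul (hsm.pow_const 2)) (b := 1 * (‖v‖ * √A) ^ 2) fun x hx => by
      rw [abs_mul, abs_pow]
      exact mul_le_mul (hIle x) (pow_le_pow_left₀ (abs_nonneg _) (hsle x hx) 2) (by positivity)
        zero_le_one
  have hf2 : Integrable (fun x => I x * s x) ν :=
    hν.integrable_of_bound (hIm.mul hsm) (b := 1 * (‖v‖ * √A)) fun x hx => by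
      rw [abs_mul]
      exact mul_le_mul (hIle x) (hsle x hx) (by positivity) zero_le_one
  have hf3 : Integrable I ν := hν.integrable_of_bound hIm (b := 1) fun x _ => hIle x
  have hrle : ∀ᵐ ω ∂P, |inner ℝ v (R ω)| ≤ ‖v‖ * rmax := by
    filter_upwards [h.noise.bounded] with ω hω
    exact (abs_real_inner_le_norm _ _).trans (mul_le_mul_of_nonneg_left hω (norm_nonneg v))
  have hvm : Measurable fun r : EuclideanSpace ℝ (Fin d) => inner ℝ v r := by fun_prop
  have hg1 : Integrable (fun ω => inner ℝ v (R ω)) P :=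
    Integrable.of_bound (hvm.comp hRm).aestronglyMeasurable _ hrle
  have hg2 : Integrable (fun ω => inner ℝ v (R ω) ^ 2) P := by
    refine Integrable.of_bound ((hvm.comp hRm).pow_const 2).aestronglyMeasurable
      ((‖v‖ * rmax) ^ 2) ?_
    filter_upwards [hrle] with ω hω
    rw [Real.norm_eq_abs, abs_pow]
    gcongr
  have hcomp : ∀ {f : EuclideanSpace ℝ (Fin K) → ℝ}, Integrable f ν →
      Integrable (fun ω => f (X ω)) P := fun {f} hf => by
    rw [← h.law] at hf
    exact hf.comp_measurable hXm
  have hlaw : ∀ {f : EuclideanSpace ℝ (Fin K) → ℝ}, Measurable f →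
      ∫ ω, f (X ω) ∂P = ∫ x, f x ∂ν := fun {f} hf => by
    rw [← h.law, integral_map hXm.aemeasurable hf.aestronglyMeasurable]
  have hind2 : IndepFun (fun ω => I (X ω) * s (X ω)) (fun ω => inner ℝ v (R ω)) P :=
    h.indep.comp (φ := fun x => I x * s x) (hIm.mul hsm) hvm
  have hind3 : IndepFun (fun ω => I (X ω)) (fun ω => inner ℝ v (R ω) ^ 2) P :=
    h.indep.comp (φ := I) (ψ := fun r => inner ℝ v r ^ 2) hIm (hvm.pow_const 2)
  have hexp : ∀ ω, I (X ω) * inner ℝ v (synth Φ (fun k => X ω k) + R ω) ^ 2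
      = I (X ω) * s (X ω) ^ 2 + 2 * (I (X ω) * s (X ω) * inner ℝ v (R ω))
        + I (X ω) * inner ℝ v (R ω) ^ 2 := fun ω => by
    rw [inner_add_right]
    ring
  have i1 := hcomp hf1
  have i2 : Integrable (fun ω => 2 * (I (X ω) * s (X ω) * inner ℝ v (R ω))) P :=
    (hind2.integrable_mul (hcomp hf2) hg1).const_mul 2
  have i3 : Integrable (fun ω => I (X ω) * inner ℝ v (R ω) ^ 2) P :=
    hind3.integrable_mul (hcomp hf3) hg2
  simp only [hexp]
  refine ⟨(i1.add i2).add i3, ?_⟩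
  have e1 : ∫ x, I x * s x ^ 2 ∂ν = ∫ x in peakSet i, s x ^ 2 ∂ν := by
    rw [← integral_indicator (measurableSet_peakSet i)]
    congr 1
    ext x
    by_cases hx : x ∈ peakSet i <;> simp [hI, hx]
  have e3 : ∫ x, I x ∂ν = ν.real (peakSet i) := by
    rw [hI, integral_indicator_const _ (measurableSet_peakSet i), smul_eq_mul, mul_one]
  have i12 : Integrable (fun ω => I (X ω) * s (X ω) ^ 2
      + 2 * (I (X ω) * s (X ω) * inner ℝ v (R ω))) P := i1.add i2
  rw [integral_add i12 i3, integral_add i1 i2, integral_const_mul,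
    hind2.integral_fun_mul_eq_mul_integral (hcomp hf2).aestronglyMeasurable
      hg1.aestronglyMeasurable,
    hind3.integral_fun_mul_eq_mul_integral (hcomp hf3).aestronglyMeasurable
      hg2.aestronglyMeasurable,
    h.noise.integral_inner_eq_zero, h.noise.integral_inner_sq,
    hlaw (f := fun x => I x * s x ^ 2) (hIm.mul (hsm.pow_const 2)), hlaw hIm, e1, e3]
  ring

lemma IsSignalModel.integral_indicator_mul_sub (h : IsSignalModel ν P X R ρ rmax)
    (hν : IsSymmetricOnSphere ν) (hpeak : ∀ᵐ x ∂ν, ∃ i, x ∈ peakSet i) (hK : 2 ≤ K)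
    {Φ : Dict d K} {A : ℝ} (hΦ : IsUnitNormTightFrame Φ A) {Ψ : Dict d K}
    (hΨ : Ψ ∈ unitDicts d K) :
    Integrable (fun ω => ∑ i, (peakSet i).indicator (fun _ => (1 : ℝ)) (X ω) *
      (inner ℝ (Ψ i) (synth Φ (fun k => X ω k) + R ω) ^ 2 -
        inner ℝ (Φ i) (synth Φ (fun k => X ω k) + R ω) ^ 2)) P ∧
    ∫ ω, ∑ i, (peakSet i).indicator (fun _ => (1 : ℝ)) (X ω) *
      (inner ℝ (Ψ i) (synth Φ (fun k => X ω k) + R ω) ^ 2 -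
        inner ℝ (Φ i) (synth Φ (fun k => X ω k) + R ω) ^ 2) ∂P
    = -(peakGain ν / K * ∑ i, (1 - inner ℝ (Ψ i) (Φ i) ^ 2)) := by
  have h1 := fun i => h.integral_indicator_mul_inner_sq hν hΦ i (Ψ i)
  have h2 := fun i => h.integral_indicator_mul_inner_sq hν hΦ i (Φ i)
  simp only [mul_sub]
  have h3 : ∀ i, Integrable (fun ω => (peakSet i).indicator (fun _ => (1 : ℝ)) (X ω) *
      inner ℝ (Ψ i) (synth Φ (fun k => X ω k) + R ω) ^ 2 -
      (peakSet i).indicator (fun _ => (1 : ℝ)) (X ω) *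
      inner ℝ (Φ i) (synth Φ (fun k => X ω k) + R ω) ^ 2) P := fun i => (h1 i).1.sub (h2 i).1
  refine ⟨integrable_finsetSum _ fun i _ => h3 i, ?_⟩
  rw [integral_finsetSum _ fun i _ => h3 i, Finset.mul_sum, ← Finset.sum_neg_distrib]
  refine Finset.sum_congr rfl fun i _ => ?_
  obtain ⟨j, hj⟩ : ∃ j : Fin K, j ≠ i := by
    have : Nontrivial (Fin K) := Fin.nontrivial_iff_two_le.mpr hK
    exact exists_ne i
  rw [integral_sub (h1 i).1 (h2 i).1, (h1 i).2, (h2 i).2,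
    hν.setIntegral_inner_synth_sq hpeak hΦ hj.symm, hν.setIntegral_inner_synth_sq hpeak hΦ hj.symm,
    real_inner_self_eq_norm_sq, hΦ.unit_norm, hΨ i]
  ring

lemma NoisyDecay.ae_exists_peak {β μ : ℝ} (hK : 2 ≤ K) (h : NoisyDecay ν β μ rmax) :
    ∀ᵐ x ∂ν, ∃ i, x ∈ peakSet i ∧ ∃ c, 0 ≤ c ∧ c < |x i| ∧ (∀ j, j ≠ i → |x j| ≤ c) ∧
      c + μ * ∑ j, |x j| + rmax ≤ β * (|x i| - c) := by
  filter_upwards [h] with x hx using exists_peak_of_decay hK hx.1 hx.2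

/-- Expected loss of a perturbed dictionary `Ψ` against `Φ`. Off the bad event the best response of
`Ψ` is at the peak, where the loss is explicit; on the bad event the response is at most the signal
energy. -/
lemma IsSignalModel.integral_maxResponse_sub_le (h : IsSignalModel ν P X R ρ rmax)
    (hν : IsSymmetricOnSphere ν) (hK : 2 ≤ K) {Φ : Dict d K} {A : ℝ}
    (hΦ : IsUnitNormTightFrame Φ A) {β : ℝ} (hβ : 0 ≤ β)
    (hdecay : NoisyDecay ν β (coherence Φ) rmax) {Ψ : Dict d K} (hΨ : Ψ ∈ unitDicts d K) :
    ∫ ω, (maxResponse Ψ (synth Φ (fun k => X ω k) + R ω) ^ 2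
        - maxResponse Φ (synth Φ (fun k => X ω k) + R ω) ^ 2) ∂P
      ≤ -(peakGain ν / K * ∑ i, (1 - inner ℝ (Ψ i) (Φ i) ^ 2))
        + (√A + rmax) ^ 2 * ν.real (badSet Φ Ψ ((1 - 2 * β) / 2)) := by
  have := hν.prob
  have hpk := hdecay.ae_exists_peak hK
  have hpeak : ∀ᵐ x ∂ν, ∃ i, x ∈ peakSet i := hpk.mono fun x hx => hx.imp fun i hi => hi.1
  set B := badSet Φ Ψ ((1 - 2 * β) / 2) with hB
  have hBm : MeasurableSet B := measurableSet_badSet _ _ _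
  obtain ⟨hint, hval⟩ := h.integral_indicator_mul_sub hν hpeak hK hΦ hΨ
  have hBint : Integrable (fun ω => (√A + rmax) ^ 2 * B.indicator (fun _ => (1 : ℝ)) (X ω)) P := by
    refine (Integrable.of_bound (((measurable_const.indicator hBm).comp
      h.measurable).aestronglyMeasurable) 1 (ae_of_all _ fun ω => ?_)).const_mul _
    by_cases hx : X ω ∈ B <;> simp [hx]
  have hBval : ∫ ω, (√A + rmax) ^ 2 * B.indicator (fun _ => (1 : ℝ)) (X ω) ∂P
      = (√A + rmax) ^ 2 * ν.real B := by
    rw [integral_const_mul, ← integral_map (f := B.indicator fun _ => (1 : ℝ))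
      h.measurable.aemeasurable (measurable_const.indicator hBm).aestronglyMeasurable, h.law,
      integral_indicator_const _ hBm, smul_eq_mul, mul_one]
  have hC := h.ae_norm_signal_sq_le hν hΦ
  have hΦu : Φ ∈ unitDicts d K := hΦ.unit_norm
  have hym := h.measurable_signal Φ
  rw [← hval, ← hBval, ← integral_add hint hBint]
  refine integral_mono_ae ?_ (hint.add hBint) ?_
  · refine Integrable.of_bound (((continuous_maxResponse_right Ψ).measurable.comp hym |>.pow_const
      2).sub ((continuous_maxResponse_right Φ).measurable.comp hym |>.pow_const
      2)).aestronglyMeasurable (2 * ‖Ψ - Φ‖ * (√A + rmax) ^ 2) ?_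
    filter_upwards [hC] with ω hω
    exact (abs_maxResponse_sq_sub_le hΨ hΦu _).trans (by gcongr)
  · filter_upwards [hC, h.ae_of_ae hpk, h.noise.bounded] with ω hω hx hr
    obtain ⟨i, hi, c, hc0, -, hxc, hdec⟩ := hx
    rw [sum_indicator_peakSet hi]
    set y := synth Φ (fun k => X ω k) + R ω
    have h1 := inner_sq_le_maxResponse_sq Φ y i
    by_cases hb : X ω ∈ B
    · have h2 : maxResponse Ψ y ^ 2 ≤ (√A + rmax) ^ 2 :=
        (pow_le_pow_left₀ (maxResponse_nonneg _ _) (maxResponse_le_norm hΨ y) 2).trans hω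
      simp only [Set.indicator_of_mem hb]
      linarith [sq_nonneg (inner ℝ (Ψ i) y)]
    · have hgood : ∀ k, |inner ℝ (Ψ k - Φ k) (synth Φ fun k => X ω k)|
          ≤ (1 - 2 * β) / 2 * |X ω i| := fun k => by
        by_contra hk
        refine hb ⟨k, ?_⟩
        rw [maxNorm_eq_of_mem_peakSet hi]
        exact not_le.mp hk
      have h2 : maxResponse Ψ y = |inner ℝ (Ψ i) y| :=
        maxResponse_eq_of_decay hΦ.unit_norm hΨ hβ hc0 hxc hdec (R ω) hr hgood
      rw [h2, sq_abs, Set.indicator_of_notMem hb]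
      linarith

/-- The decay condition forces `β ≥ 0` and limits the noise level by `β`. -/
lemma NoisyDecay.nonneg_and_rmax_le (hν : IsSymmetricOnSphere ν) (hK : 2 ≤ K) {Φ : Dict d K}
    {β : ℝ} (hr : 0 ≤ rmax) (h : NoisyDecay ν β (coherence Φ) rmax) : 0 ≤ β ∧ rmax ≤ β := by
  have := hν.prob
  obtain ⟨x, ⟨i, -, c, hc, hci, -, hdec⟩, hx⟩ := ((h.ae_exists_peak hK).and hν.on_sphere).exists
  have h1 : 0 ≤ coherence Φ * ∑ j, |x j| :=
    mul_nonneg (coherence_nonneg Φ) (Finset.sum_nonneg fun j _ => abs_nonneg _)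
  have h2 := abs_apply_le_one hx i
  have hβ : 0 ≤ β := by
    by_contra hneg
    nlinarith
  exact ⟨hβ, by nlinarith⟩

end

section

/-! ### Nets and concentration -/

/-- Volume comparison: a separated set in a ball of a finite-dimensional space is small. -/
lemma card_le_of_separated {E : Type*} [NormedAddCommGroup E] [NormedSpace ℝ E]
    [FiniteDimensional ℝ E] {c : E} {η δ : ℝ} (hη : 0 ≤ η) (hδ : 0 < δ) (T : Finset E)
    (hT : ∀ x ∈ T, ‖x - c‖ ≤ η) (hsep : ∀ x ∈ T, ∀ y ∈ T, x ≠ y → δ < ‖x - y‖) :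
    (T.card : ℝ) ≤ (1 + 2 * η / δ) ^ Module.finrank ℝ E := by
  borelize E
  let m : Measure E := Measure.addHaar
  have hdisj : Set.PairwiseDisjoint (T : Set E) fun x => Metric.ball x (δ / 2) := by
    intro x hx y hy hxy
    refine Metric.ball_disjoint_ball ?_
    rw [dist_eq_norm]
    linarith [hsep x hx y hy hxy]
  have hsub : ⋃ x ∈ T, Metric.ball x (δ / 2) ⊆ Metric.ball c (η + δ / 2) := by
    refine Set.iUnion₂_subset fun x hx => Metric.ball_subset_ball' ?_
    rw [dist_eq_norm]
    linarith [hT x hx]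
  have h1 : (T.card : ℝ) * ((δ / 2) ^ Module.finrank ℝ E * m.real (Metric.ball 0 1))
      ≤ (η + δ / 2) ^ Module.finrank ℝ E * m.real (Metric.ball 0 1) := by
    have hball : ∀ (x : E) {r : ℝ}, 0 < r →
        m.real (Metric.ball x r) = r ^ Module.finrank ℝ E * m.real (Metric.ball 0 1) :=
      fun x r hr => by
        rw [measureReal_def, Measure.addHaar_ball_of_pos m x hr, ENNReal.toReal_mul,
          ENNReal.toReal_ofReal (by positivity), measureReal_def]
    have h2 := measureReal_mono (μ := m) hsub measure_ball_lt_top.ne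
    rw [measureReal_biUnion_finset hdisj (fun x _ => measurableSet_ball)
      (fun x _ => measure_ball_lt_top.ne), hball c (by positivity),
      Finset.sum_congr rfl fun x _ => hball x (half_pos hδ)] at h2
    simpa using h2
  have hpos : 0 < m.real (Metric.ball (0 : E) 1) :=
    ENNReal.toReal_pos (Metric.measure_ball_pos m 0 one_pos).ne' measure_ball_lt_top.ne
  rw [← mul_assoc] at h1
  have h3 := le_of_mul_le_mul_right h1 hpos
  rw [← le_div_iff₀ (by positivity), ← div_pow] at h3
  refine h3.trans_eq ?_
  congr 1
  field_simp
  ring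

lemma exists_net {E : Type*} [NormedAddCommGroup E] [NormedSpace ℝ E] [FiniteDimensional ℝ E]
    {c : E} {η δ : ℝ} (hη : 0 ≤ η) (hδ : 0 < δ) {S : Set E} (hS : ∀ x ∈ S, ‖x - c‖ ≤ η) :
    ∃ T : Finset E, (∀ x ∈ T, x ∈ S) ∧ (∀ x ∈ S, ∃ y ∈ T, ‖x - y‖ ≤ δ) ∧
      (T.card : ℝ) ≤ (1 + 2 * η / δ) ^ Module.finrank ℝ E := by
  classical
  -- a separated subset of maximal cardinality is a net
  set Q : Finset E → Prop := fun T => (∀ x ∈ T, x ∈ S) ∧ ∀ x ∈ T, ∀ y ∈ T, x ≠ y → δ < ‖x - y‖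
    with hQ
  have hcard : ∀ T, Q T → (T.card : ℝ) ≤ (1 + 2 * η / δ) ^ Module.finrank ℝ E := fun T hT =>
    card_le_of_separated hη hδ T (fun x hx => hS x (hT.1 x hx)) hT.2
  have hmem : sSup {n | ∃ T, Q T ∧ T.card = n} ∈ {n | ∃ T, Q T ∧ T.card = n} := by
    refine Nat.sSup_mem ⟨0, ∅, by simp [hQ]⟩ ⟨⌊(1 + 2 * η / δ) ^ Module.finrank ℝ E⌋₊, ?_⟩
    rintro n ⟨T, hT, rfl⟩
    exact Nat.le_floor (hcard T hT)
  have hbdd : BddAbove {n | ∃ T, Q T ∧ T.card = n} := by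
    refine ⟨⌊(1 + 2 * η / δ) ^ Module.finrank ℝ E⌋₊, ?_⟩
    rintro n ⟨T, hT, rfl⟩
    exact Nat.le_floor (hcard T hT)
  obtain ⟨T, hT, hTmax⟩ := hmem
  refine ⟨T, hT.1, fun x hx => ?_, hcard T hT⟩
  by_contra! hfar
  have hxT : x ∉ T := fun h => by
    have := hfar x h
    rw [sub_self, norm_zero] at this
    exact lt_asymm hδ this
  have hins : Q (insert x T) := by
    refine ⟨?_, ?_⟩
    · simp only [Finset.mem_insert, forall_eq_or_imp]
      exact ⟨hx, hT.1⟩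
    · intro y hy z hz hyz
      rcases Finset.mem_insert.mp hy with rfl | hy' <;>
        rcases Finset.mem_insert.mp hz with rfl | hz'
      · exact absurd rfl hyz
      · exact hfar z hz'
      · rw [norm_sub_rev]
        exact hfar y hy'
      · exact hT.2 y hy' z hz' hyz
  have := le_csSup hbdd ⟨insert x T, hins, rfl⟩
  rw [← hTmax, Finset.card_insert_of_notMem hxT] at this
  omega

/-- **Hoeffding's inequality** for independent variables bounded by `W` with means at most `-m`. -/
lemma measureReal_sum_ge_le_of_abs_le {Ω : Type*} [MeasurableSpace Ω] {P : Measure Ω}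
    [IsProbabilityMeasure P] {N : ℕ} (hN : 0 < N) {Z : Fin N → Ω → ℝ} (hindep : iIndepFun Z P)
    (hZ : ∀ n, Measurable (Z n)) {W : ℝ} (hb : ∀ n, ∀ᵐ ω ∂P, |Z n ω| ≤ W) {m t : ℝ}
    (hm : ∀ n, ∫ ω, Z n ω ∂P ≤ -m) (ht : 0 ≤ t) :
    P.real {ω | N * (t - m) ≤ ∑ n, Z n ω} ≤ Real.exp (-(N * t ^ 2) / (2 * W ^ 2)) := by
  have hsub : ∀ n, HasSubgaussianMGF (fun ω => Z n ω - ∫ ω, Z n ω ∂P)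
      ((‖W - -W‖₊ / 2) ^ 2) P := fun n =>
    hasSubgaussianMGF_of_mem_Icc (hZ n).aemeasurable ((hb n).mono fun ω h => abs_le.mp h)
  have hind : iIndepFun (fun n ω => Z n ω - ∫ ω, Z n ω ∂P) P :=
    hindep.comp (fun n z => z - ∫ ω, Z n ω ∂P) fun n => measurable_id.sub_const _
  have h := HasSubgaussianMGF.measure_sum_ge_le_of_iIndepFun hind
    (s := Finset.univ) (fun n _ => hsub n) (ε := N * t) (by positivity)
  refine (measureReal_mono fun ω hω => ?_).trans (h.trans_eq ?_)
  · have h1 : ∑ n, ∫ ω, Z n ω ∂P ≤ ∑ _n : Fin N, -m := Finset.sum_le_sum fun n _ => hm n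
    simp only [Set.mem_ofPred_eq, Finset.sum_sub_distrib] at hω ⊢
    simp only [Finset.sum_const, Finset.card_univ, Fintype.card_fin, nsmul_eq_mul] at h1
    linarith
  · have hN' : (N : ℝ) ≠ 0 := by positivity
    have hW : ((‖W - -W‖₊ / 2 : NNReal) : ℝ) ^ 2 = W ^ 2 := by
      simp only [NNReal.coe_div, coe_nnnorm, Real.norm_eq_abs, NNReal.coe_ofNat]
      rw [div_pow, sq_abs]
      ring
    congr 1
    simp only [Finset.sum_const, Finset.card_univ, Fintype.card_fin, nsmul_eq_mul,
      NNReal.coe_mul, NNReal.coe_natCast, NNReal.coe_pow, hW]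
    rcases eq_or_ne W 0 with rfl | hW0
    · simp
    · field_simp

/-! ### The constants -/

/-- An atom at distance exactly `η` from a unit vector has lost correlation `η² - η⁴/4`. -/
lemma one_sub_inner_sq_eq {d : ℕ} {ψ φ : EuclideanSpace ℝ (Fin d)} (hψ : ‖ψ‖ = 1) (hφ : ‖φ‖ = 1) :
    1 - inner ℝ ψ φ ^ 2 = ‖ψ - φ‖ ^ 2 - ‖ψ - φ‖ ^ 4 / 4 := by
  have h := norm_sub_sq_real ψ φ
  rw [hψ, hφ] at h
  have h2 : ‖ψ - φ‖ ^ 4 = (‖ψ - φ‖ ^ 2) ^ 2 := by ring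
  rw [h2, h]
  ring

lemma le_log_of_eight_le {z : ℝ} (hz : 8 ≤ z) : (207 : ℝ) / 100 ≤ Real.log z := by
  have h1 : Real.log 8 ≤ Real.log z := Real.log_le_log (by norm_num) hz
  have h2 : Real.log 8 = 3 * Real.log 2 := by
    rw [show (8 : ℝ) = 2 ^ 3 by norm_num, Real.log_pow]
    norm_num
  have := Real.log_two_gt_d9
  linarith

/-- The exponential tail beats the square of the radius. With `v = 1 / (4 η) ≥ L` the claim is the
square of `4 v ≤ exp (L (v - 1))`, which holds already for the tangent of `exp` at `2`. -/
lemma exp_sub_le_sq {L η : ℝ} (hη : 0 < η) (hL : 207 / 100 ≤ L) (hLη : 4 * L * η ≤ 1) :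
    Real.exp (2 * L - L / (2 * η)) ≤ η ^ 2 := by
  set v := 1 / (4 * η) with hv
  have hvη : 4 * v * η = 1 := by
    rw [hv]
    field_simp
  have hLv : L ≤ v := by
    rw [hv, le_div_iff₀ (by positivity)]
    linarith
  have hexp2 : (738 : ℝ) / 100 ≤ Real.exp 2 := by
    have h1 := Real.exp_one_gt_d9
    have h2 : Real.exp 2 = Real.exp 1 * Real.exp 1 := by
      rw [← Real.exp_add]
      norm_num
    rw [h2]
    nlinarith
  have hlin : 4 * v ≤ Real.exp (L * (v - 1)) := by
    have h1 : Real.exp (L * (v - 1)) = Real.exp 2 * Real.exp (L * (v - 1) - 2) := by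
      rw [← Real.exp_add]
      congr 1
      ring
    have h2 := Real.add_one_le_exp (L * (v - 1) - 2)
    have h3 : 207 / 100 * (v - 1) ≤ L * (v - 1) := by
      apply mul_le_mul_of_nonneg_right hL
      linarith
    rw [h1]
    nlinarith
  have h4 : Real.exp (L - L * v) ≤ η := by
    have h5 : L - L * v = -(L * (v - 1)) := by ring
    rw [h5, Real.exp_neg]
    refine inv_le_of_inv_le₀ hη (hlin.trans' (le_of_eq ?_))
    field_simp
    linarith
  have h6 : Real.exp (2 * L - L / (2 * η)) = Real.exp (L - L * v) ^ 2 := by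
    rw [← Real.exp_nat_mul]
    congr 1
    rw [hv]
    push_cast
    field_simp
    ring
  rw [h6]
  gcongr

/-- The contribution of the bad event is a fraction of the loss `λ η² / K` at the boundary. -/
lemma bad_event_cost_le {A C κ lam η θ L : ℝ} (hA : 1 ≤ A) (hκ : 2 ≤ κ) (hlam : 0 < lam)
    (hlam1 : lam ≤ 1) (hη : 0 < η) (hC : C ≤ 9 / 4 * A) (hL : L = Real.log (4 * A * κ / lam))
    (hL2 : 207 / 100 ≤ L) (hLη : 4 * L * η ≤ 1) (hθ : 4 * A * L * η ≤ θ ^ 2) :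
    C * (2 * κ * Real.exp (-(θ / 2) ^ 2 / (2 * (A * η ^ 2)))) ≤ 3 / 10 * (lam * η ^ 2 / κ) := by
  have hAκ : 0 < 4 * A * κ / lam := by positivity
  have hexpL : Real.exp L = 4 * A * κ / lam := by rw [hL, Real.exp_log hAκ]
  have h1 : Real.exp (-(θ / 2) ^ 2 / (2 * (A * η ^ 2))) ≤ Real.exp (-(L / (2 * η))) := by
    rw [Real.exp_le_exp, neg_div, neg_le_neg_iff, div_le_div_iff₀ (by positivity) (by positivity)]
    nlinarith
  have hsq := exp_sub_le_sq hη hL2 hLη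
  have h2 : Real.exp (2 * L - L / (2 * η))
      = (4 * A * κ / lam) ^ 2 * Real.exp (-(L / (2 * η))) := by
    rw [← hexpL, ← Real.exp_nat_mul, ← Real.exp_add]
    congr 1
  rw [h2] at hsq
  set e := Real.exp (-(L / (2 * η)))
  have he : 0 < e := Real.exp_pos _
  have h3 : 16 * A ^ 2 * κ ^ 2 * e ≤ lam ^ 2 * η ^ 2 := by
    have h4 : (4 * A * κ / lam) ^ 2 * e = 16 * A ^ 2 * κ ^ 2 * e / lam ^ 2 := by
      field_simp
      ring
    rw [h4, div_le_iff₀ (by positivity)] at hsq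
    linarith
  calc C * (2 * κ * Real.exp (-(θ / 2) ^ 2 / (2 * (A * η ^ 2))))
      ≤ (9 / 4 * A) * (2 * κ * e) := by gcongr
    _ ≤ 3 / 10 * (lam * η ^ 2 / κ) := by
        rw [← mul_div_assoc, le_div_iff₀ (by positivity)]
        have h5 : A * κ ^ 2 * e ≤ A ^ 2 * κ ^ 2 * e := by
          have : A ≤ A ^ 2 := by nlinarith
          gcongr
        have h6 : lam ^ 2 * η ^ 2 ≤ lam * η ^ 2 := by
          have : lam ^ 2 ≤ lam := by nlinarith
          gcongr
        nlinarith

end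

section

/-! ### Uniform control over the boundary -/

variable {d K N : ℕ} {Ω : Type*} [MeasurableSpace Ω] {P : Measure Ω} [IsProbabilityMeasure P]

/-- If at every dictionary at distance `η` from `Φ` the expected response is smaller than at `Φ` by
`m`, then a net of mesh `δ` and a deviation `t` with `2 C δ + t ≤ m` show that with high probability
there is a local maximum within distance `η`. -/
lemma measure_not_exists_isLocalMaxOn_le (hN : 0 < N) {Φ : Dict d K} (hΦ : Φ ∈ unitDicts d K)
    {Y : Fin N → Ω → EuclideanSpace ℝ (Fin d)} (hY : ∀ n, Measurable (Y n))
    (hindep : iIndepFun Y P) {C : ℝ} (hC : ∀ n, ∀ᵐ ω ∂P, ‖Y n ω‖ ^ 2 ≤ C) {η δ m t : ℝ}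
    (hη : 0 < η) (hδ : 0 < δ) (ht : 0 ≤ t) (hmt : 2 * C * δ + t ≤ m)
    (hmean : ∀ Ψ ∈ unitDicts d K, ‖Ψ - Φ‖ = η → ∀ n,
      ∫ ω, (maxResponse Ψ (Y n ω) ^ 2 - maxResponse Φ (Y n ω) ^ 2) ∂P ≤ -m) :
    P {ω | ¬ ∃ Ψ ∈ unitDicts d K,
        IsLocalMaxOn (maxCriterion fun n => Y n ω) (unitDicts d K) Ψ ∧ ‖Ψ - Φ‖ ≤ η}
      ≤ ENNReal.ofReal ((1 + 2 * η / δ) ^ (K * d) *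
          Real.exp (-(N * t ^ 2) / (2 * (2 * η * C) ^ 2))) := by
  obtain ⟨T, hTS, hTnet, hTcard⟩ := exists_net (c := Φ) hη.le hδ
    (S := {Ψ | Ψ ∈ unitDicts d K ∧ ‖Ψ - Φ‖ = η}) fun Ψ hΨ => hΨ.2.le
  have hfin : Module.finrank ℝ (Dict d K) = K * d := by
    rw [Module.finrank_pi_fintype]
    simp
  rw [hfin] at hTcard
  set Z : Dict d K → Fin N → Ω → ℝ := fun Ψ n ω =>
    maxResponse Ψ (Y n ω) ^ 2 - maxResponse Φ (Y n ω) ^ 2 with hZ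
  set G : Dict d K → Set Ω := fun Ψ => {ω | N * (t - m) ≤ ∑ n, Z Ψ n ω} with hG
  set E := Real.exp (-(N * t ^ 2) / (2 * (2 * η * C) ^ 2)) with hE
  have hgm : ∀ Ψ : Dict d K, Measurable fun y : EuclideanSpace ℝ (Fin d) =>
      maxResponse Ψ y ^ 2 - maxResponse Φ y ^ 2 := fun Ψ =>
    (((continuous_maxResponse_right Ψ).pow 2).sub
      ((continuous_maxResponse_right Φ).pow 2)).measurable
  have hGle : ∀ Ψ ∈ T, P.real (G Ψ) ≤ E := fun Ψ hΨ => by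
    refine measureReal_sum_ge_le_of_abs_le hN
      (hindep.comp (fun _ y => maxResponse Ψ y ^ 2 - maxResponse Φ y ^ 2) fun _ => hgm Ψ)
      (fun n => (hgm Ψ).comp (hY n)) (fun n => ?_) (hmean Ψ (hTS Ψ hΨ).1 (hTS Ψ hΨ).2) ht
    filter_upwards [hC n] with ω hω
    refine (abs_maxResponse_sq_sub_le (hTS Ψ hΨ).1 hΦ _).trans ?_
    rw [(hTS Ψ hΨ).2]
    gcongr
  have hC' : ∀ᵐ ω ∂P, ∀ n, ‖Y n ω‖ ^ 2 ≤ C := ae_all_iff.mpr hC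
  have hsub : {ω | ¬ ∃ Ψ ∈ unitDicts d K,
      IsLocalMaxOn (maxCriterion fun n => Y n ω) (unitDicts d K) Ψ ∧ ‖Ψ - Φ‖ ≤ η}
      ⊆ (⋃ Ψ ∈ T, G Ψ) ∪ {ω | ¬ ∀ n, ‖Y n ω‖ ^ 2 ≤ C} := by
    intro ω hω
    by_contra hnot
    simp only [Set.mem_union, Set.mem_iUnion, not_or, not_exists, Set.mem_ofPred_eq,
      not_not] at hnot
    obtain ⟨hgood, hYC⟩ := hnot
    refine hω (exists_isLocalMaxOn_of_boundary (continuous_maxCriterion _) hΦ hη fun Ψ hΨ hΨη => ?_)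
    obtain ⟨Ψ', hΨ', hdist⟩ := hTnet Ψ ⟨hΨ, hΨη⟩
    have h1 : ∑ n, Z Ψ' n ω < N * (t - m) := not_le.mp (hgood Ψ' hΨ')
    have h2 : ∑ n, (maxResponse Ψ (Y n ω) ^ 2 - maxResponse Ψ' (Y n ω) ^ 2)
        ≤ ∑ _n : Fin N, 2 * C * δ := by
      refine Finset.sum_le_sum fun n _ => (le_abs_self _).trans
        ((abs_maxResponse_sq_sub_le hΨ (hTS Ψ' hΨ').1 _).trans ?_)
      calc 2 * ‖Ψ - Ψ'‖ * ‖Y n ω‖ ^ 2 ≤ 2 * δ * C := by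
            gcongr
            exact hYC n
        _ = 2 * C * δ := by ring
    simp only [Finset.sum_const, Finset.card_univ, Fintype.card_fin, nsmul_eq_mul] at h2
    have h3 : ∑ n, maxResponse Ψ (Y n ω) ^ 2 - ∑ n, maxResponse Φ (Y n ω) ^ 2 ≤ 0 := by
      have h4 : ∑ n, maxResponse Ψ (Y n ω) ^ 2 - ∑ n, maxResponse Φ (Y n ω) ^ 2
          = ∑ n, (maxResponse Ψ (Y n ω) ^ 2 - maxResponse Ψ' (Y n ω) ^ 2) + ∑ n, Z Ψ' n ω := by
        simp only [hZ, Finset.sum_sub_distrib]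
        ring
      have h5 : (N : ℝ) * (2 * C * δ + t - m) ≤ 0 :=
        mul_nonpos_of_nonneg_of_nonpos (Nat.cast_nonneg N) (by linarith)
      rw [h4]
      linarith
    exact mul_le_mul_of_nonneg_left (sub_nonpos.mp h3) (by positivity)
  calc _ ≤ P ((⋃ Ψ ∈ T, G Ψ) ∪ {ω | ¬ ∀ n, ‖Y n ω‖ ^ 2 ≤ C}) := measure_mono hsub
    _ ≤ P (⋃ Ψ ∈ T, G Ψ) + P {ω | ¬ ∀ n, ‖Y n ω‖ ^ 2 ≤ C} := measure_union_le _ _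
    _ = P (⋃ Ψ ∈ T, G Ψ) := by rw [ae_iff.mp hC', add_zero]
    _ ≤ ∑ Ψ ∈ T, P (G Ψ) := measure_biUnion_finset_le _ _
    _ ≤ ∑ _Ψ ∈ T, ENNReal.ofReal E := Finset.sum_le_sum fun Ψ hΨ => by
        rw [← ofReal_measureReal]
        exact ENNReal.ofReal_le_ofReal (hGle Ψ hΨ)
    _ = ENNReal.ofReal (T.card * E) := by
        rw [Finset.sum_const, nsmul_eq_mul, ENNReal.ofReal_mul (Nat.cast_nonneg _),
          ENNReal.ofReal_natCast]
    _ ≤ ENNReal.ofReal ((1 + 2 * η / δ) ^ (K * d) * E) := by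
        gcongr

/-- Loss at the boundary: some atom has distance exactly `η` from its counterpart. -/
lemma sq_sub_le_sum_one_sub_inner_sq (hK : 0 < K) {Φ Ψ : Dict d K} (hΦ : Φ ∈ unitDicts d K)
    (hΨ : Ψ ∈ unitDicts d K) {η : ℝ} (hη : ‖Ψ - Φ‖ = η) :
    η ^ 2 - η ^ 4 / 4 ≤ ∑ k, (1 - inner ℝ (Ψ k) (Φ k) ^ 2) := by
  have : Nonempty (Fin K) := ⟨⟨0, hK⟩⟩
  obtain ⟨k, hk⟩ := Finite.exists_max fun k => ‖Ψ k - Φ k‖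
  have hkη : ‖Ψ k - Φ k‖ = η := by
    rw [← hη]
    exact le_antisymm (norm_le_pi_norm (Ψ - Φ) k)
      ((pi_norm_le_iff_of_nonneg (norm_nonneg _)).mpr hk)
  have hnn : ∀ j ∈ Finset.univ, 0 ≤ 1 - inner ℝ (Ψ j) (Φ j) ^ 2 := fun j _ => by
    have := abs_real_inner_le_norm (Ψ j) (Φ j)
    rw [hΨ j, hΦ j, mul_one] at this
    linarith [(sq_le_one_iff_abs_le_one (inner ℝ (Ψ j) (Φ j) : ℝ)).mpr this]
  refine le_trans (le_of_eq ?_) (Finset.single_le_sum hnn (Finset.mem_univ k))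
  rw [one_sub_inner_sq_eq (hΨ k) (hΦ k), hkη]

/-- Expected loss at the boundary: the loss of correlation outweighs the cost of the bad event. -/
lemma IsSignalModel.integral_maxResponse_sub_le_of_norm_sub_eq
    {ν : Measure (EuclideanSpace ℝ (Fin K))} {X : Ω → EuclideanSpace ℝ (Fin K)}
    {R : Ω → EuclideanSpace ℝ (Fin d)} {ρ rmax : ℝ} (h : IsSignalModel ν P X R ρ rmax)
    (hν : IsSymmetricOnSphere ν) (hK : 2 ≤ K) {Φ : Dict d K} {A : ℝ}
    (hΦ : IsUnitNormTightFrame Φ A) (hA1 : 1 ≤ A) {β : ℝ} (hβ0 : 0 ≤ β) (hβ : β < 1 / 2)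
    (hdecay : NoisyDecay ν β (coherence Φ) rmax) (hC : (√A + rmax) ^ 2 ≤ 9 / 4 * A)
    (hlam0 : 0 < peakGain ν) (hlam1 : peakGain ν ≤ 1) {η L : ℝ} (hη0 : 0 < η) (hη8 : 8 * η ≤ 1)
    (hL : L = Real.log (4 * A * K / peakGain ν)) (hL2 : 207 / 100 ≤ L) (hLη : 4 * L * η ≤ 1)
    (hθ : 4 * A * L * η ≤ (1 - 2 * β) ^ 2) {Ψ : Dict d K} (hΨ : Ψ ∈ unitDicts d K)
    (hΨη : ‖Ψ - Φ‖ = η) :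
    ∫ ω, (maxResponse Ψ (synth Φ (fun k => X ω k) + R ω) ^ 2
        - maxResponse Φ (synth Φ (fun k => X ω k) + R ω) ^ 2) ∂P
      ≤ -(6 / 10 * (peakGain ν * η ^ 2 / K)) := by
  have hK2 : (2 : ℝ) ≤ K := by exact_mod_cast hK
  refine (h.integral_maxResponse_sub_le hν hK hΦ hβ0 hdecay hΨ).trans ?_
  have hloss := sq_sub_le_sum_one_sub_inner_sq (by omega) hΦ.unit_norm hΨ hΨη
  set s := ∑ k, (1 - inner ℝ (Ψ k) (Φ k) ^ 2)
  have h1 : 9 / 10 * η ^ 2 ≤ s := by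
    have h2 : η ^ 2 ≤ (1 / 8) ^ 2 := pow_le_pow_left₀ hη0.le (by linarith) 2
    have h3 : η ^ 4 ≤ (1 / 8) ^ 2 * η ^ 2 := by
      calc η ^ 4 = η ^ 2 * η ^ 2 := by ring
        _ ≤ (1 / 8) ^ 2 * η ^ 2 := by gcongr
    have := sq_nonneg η
    linarith
  have h2 : 9 / 10 * (peakGain ν * η ^ 2 / K) ≤ peakGain ν / K * s := by
    calc 9 / 10 * (peakGain ν * η ^ 2 / K) = peakGain ν / K * (9 / 10 * η ^ 2) := by ring
      _ ≤ peakGain ν / K * s := by gcongr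
  have h4 := hν.measureReal_badSet_le hΦ (by linarith) hΨη.le (τ := (1 - 2 * β) / 2) (by linarith)
  have h5 := bad_event_cost_le hA1 hK2 hlam0 hlam1 hη0 hC hL hL2 hLη hθ
  have h6 := mul_le_mul_of_nonneg_left h4 (sq_nonneg (√A + rmax))
  linarith

/-- The union bound over the net is at most the stated probability bound: as `η` is small, `N` is
so large that the constants in the size of the net and in the exponent are absorbed. -/
lemma net_card_mul_exp_le (hN : 1 ≤ N) (hK2 : (2 : ℝ) ≤ K) {A C lam q η : ℝ} (hlam0 : 0 < lam)
    (hlam1 : lam ≤ 1) (hA1 : 1 ≤ A) (hC1 : 1 ≤ C) (hC2 : C ≤ 9 / 4 * A) (hq1 : q < 1 / 4)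
    (hη : η = (N : ℝ) ^ (-q)) (hAη : 8 * A * η ≤ 1) :
    (1 + 2 * η / (lam * η ^ 2 / (20 * K * C))) ^ (K * d) *
        Real.exp (-(N * (5 / 10 * (lam * η ^ 2 / K)) ^ 2) / (2 * (2 * η * C) ^ 2))
      ≤ Real.exp (-((N : ℝ) ^ (1 - 4 * q) * lam ^ 2) / (4 * (K : ℝ) ^ 2 * C)
            + (K : ℝ) * (d : ℝ) * Real.log ((N : ℝ) * (K : ℝ) * C / lam)) := by
  have hN0 : (0 : ℝ) < N := by exact_mod_cast hN
  have hN1 : (1 : ℝ) ≤ N := by exact_mod_cast hN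
  have hη0 : 0 < η := hη ▸ Real.rpow_pos_of_pos hN0 _
  have hη8 : 8 * η ≤ 1 := by nlinarith
  -- `N η⁴ = N ^ (1 - 4 q) ≥ 1`, which is where `q < 1/4` enters
  have hη4 : (N : ℝ) ^ (1 - 4 * q) = N * η ^ 4 := by
    rw [hη, ← Real.rpow_natCast, ← Real.rpow_mul hN0.le, sub_eq_add_neg, Real.rpow_add hN0,
      Real.rpow_one]
    congr 2
    push_cast
    ring
  have hNη : 1 ≤ N * η ^ 4 := by
    rw [← hη4]
    exact Real.one_le_rpow hN1 (by linarith)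
  set M := (N : ℝ) * K * C / lam with hM
  have hM0 : 0 < M := by positivity
  have hnet : 1 + 2 * η / (lam * η ^ 2 / (20 * K * C)) ≤ M := by
    have h1 : 2 * η / (lam * η ^ 2 / (20 * K * C)) = 40 * K * C / (lam * η) := by
      field_simp
      norm_num
    have h2 : 41 ≤ N * η := by
      have h3 : N * η ^ 4 ≤ N * η * (1 / 512) := by
        have : η ^ 3 ≤ (1 / 8) ^ 3 := by
          gcongr
          linarith
        calc N * η ^ 4 = N * η * η ^ 3 := by ring
          _ ≤ N * η * (1 / 512) := by
            gcongr
            linarith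
      linarith
    have h4 : 1 ≤ K * C := by nlinarith
    have h5 : M = (K * C) * (N * η) / (lam * η) := by
      rw [hM]
      field_simp
    have h6 : (41 : ℝ) * (K * C) ≤ K * C * (N * η) := by nlinarith
    have h7 : lam * η ≤ 1 := by nlinarith
    have h8 : 0 < lam * η := by positivity
    rw [h1, h5, ← sub_nonneg]
    have h9 : K * C * (N * η) / (lam * η) - (1 + 40 * K * C / (lam * η))
        = (K * C * (N * η) - 40 * (K * C) - lam * η) / (lam * η) := by
      field_simp
      ring
    rw [h9]
    exact div_nonneg (by linarith) h8.le
  have hexp : -(N * (5 / 10 * (lam * η ^ 2 / K)) ^ 2) / (2 * (2 * η * C) ^ 2)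
      ≤ -((N : ℝ) ^ (1 - 4 * q) * lam ^ 2) / (4 * (K : ℝ) ^ 2 * C) := by
    rw [hη4, neg_div, neg_div, neg_le_neg_iff]
    have h1 : N * (5 / 10 * (lam * η ^ 2 / K)) ^ 2 / (2 * (2 * η * C) ^ 2)
        = (N * lam ^ 2 / (4 * K ^ 2 * C)) * (η ^ 2 / (8 * C)) := by
      field_simp
      norm_num
    have h2 : N * η ^ 4 * lam ^ 2 / (4 * K ^ 2 * C)
        = (N * lam ^ 2 / (4 * K ^ 2 * C)) * η ^ 4 := by ring
    rw [h1, h2]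
    gcongr
    rw [le_div_iff₀ (by positivity)]
    have h3 : 8 * C * η ^ 2 ≤ 1 := by
      calc 8 * C * η ^ 2 ≤ 8 * (9 / 4 * A) * η ^ 2 := by gcongr
        _ = 9 / 4 * (8 * A * η) * η := by ring
        _ ≤ 9 / 4 * 1 * η := by gcongr
        _ ≤ 1 := by linarith
    calc η ^ 4 * (8 * C) = 8 * C * η ^ 2 * η ^ 2 := by ring
      _ ≤ 1 * η ^ 2 := by gcongr
      _ = η ^ 2 := one_mul _
  calc (1 + 2 * η / (lam * η ^ 2 / (20 * K * C))) ^ (K * d) *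
        Real.exp (-(N * (5 / 10 * (lam * η ^ 2 / K)) ^ 2) / (2 * (2 * η * C) ^ 2))
      ≤ M ^ (K * d) * Real.exp (-((N : ℝ) ^ (1 - 4 * q) * lam ^ 2) / (4 * (K : ℝ) ^ 2 * C)) := by
        gcongr
    _ = _ := by
        rw [Real.exp_add, mul_comm]
        congr 1
        rw [← Nat.cast_mul, Real.exp_nat_mul, Real.exp_log hM0]

end

end KSVD

open KSVD in
theorem mainTheorem1 {d K N : ℕ} (hK : 2 ≤ K) (hN : 1 ≤ N)
    -- the generating dictionary
    (Φ : KSVD.Dict d K) (A μ : ℝ) (hA : A = (K : ℝ) / (d : ℝ))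
    (hΦ : KSVD.IsUnitNormTightFrame Φ A) (hμ : μ = KSVD.coherence Φ)
    -- the coefficient distribution
    (ν : Measure (EuclideanSpace ℝ (Fin K))) (hν : KSVD.IsSymmetricOnSphere ν)
    (β ρ rmax : ℝ) (hβ : β < 1 / 2) (hdecay : KSVD.NoisyDecay ν β μ rmax)
    -- the random signals `y_n = Φ x_n + r_n`
    {Ω : Type*} [MeasurableSpace Ω] (P : Measure Ω) [IsProbabilityMeasure P]
    (x : Fin N → Ω → EuclideanSpace ℝ (Fin K)) (r : Fin N → Ω → EuclideanSpace ℝ (Fin d))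
    (hx : ∀ n, Measurable (x n)) (hxlaw : ∀ n, P.map (x n) = ν)
    (hr : ∀ n, KSVD.IsBoundedWhiteNoise P (r n) ρ rmax)
    (hindep : iIndepFun (fun n ω => (x n ω, r n ω)) P)
    (hindep_noise : ∀ n, IndepFun (x n) (r n) P)
    (y : Fin N → Ω → EuclideanSpace ℝ (Fin d))
    (hy : ∀ n ω, y n ω = KSVD.synth Φ (fun k => x n ω k) + r n ω)
    -- the constants and the sample size
    (lam C_L : ℝ)
    (hlam : lam = KSVD.meanMaxSq ν - (1 - KSVD.meanMaxSq ν) / ((K : ℝ) - 1))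
    (hC_L : C_L = (Real.sqrt A + rmax) ^ 2)
    (q : ℝ) (hq0 : 0 < q) (hq1 : q < 1 / 4)
    (hsample : (N : ℝ) ^ (-q) + (N : ℝ) ^ (-(2 * q)) / (K : ℝ)
      ≤ (1 - 2 * β) ^ 2 / (4 * A * Real.log (4 * A * (K : ℝ) / lam))) :
    P {ω | ¬ ∃ Ψ ∈ KSVD.unitDicts d K,
          IsLocalMaxOn (KSVD.maxCriterion (fun n => y n ω)) (KSVD.unitDicts d K) Ψ ∧
          KSVD.IsKSVDLocalMin 1 (fun n => y n ω) Ψ ∧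
          ∀ k, ‖Ψ k - Φ k‖ ≤ 2 * (N : ℝ) ^ (-q)}
      ≤ ENNReal.ofReal (Real.exp
          (-((N : ℝ) ^ (1 - 4 * q) * lam ^ 2) / (4 * (K : ℝ) ^ 2 * C_L)
            + (K : ℝ) * (d : ℝ) * Real.log ((N : ℝ) * (K : ℝ) * C_L / lam))) := by
  subst hμ
  have hN0 : (0 : ℝ) < N := by exact_mod_cast hN
  have hN1 : (1 : ℝ) ≤ N := by exact_mod_cast hN
  have hK2 : (2 : ℝ) ≤ K := by exact_mod_cast hK
  have hΦu : Φ ∈ unitDicts d K := hΦ.unit_norm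
  have hsig : ∀ n, IsSignalModel ν P (x n) (r n) ρ rmax := fun n =>
    ⟨hx n, hxlaw n, hr n, hindep_noise n⟩
  have hr0 : 0 ≤ rmax := (hr ⟨0, hN⟩).rmax_nonneg
  obtain ⟨hβ0, hrβ⟩ := hdecay.nonneg_and_rmax_le hν hK hr0
  have hpeak : ∀ᵐ x ∂ν, ∃ i, x ∈ peakSet i :=
    (hdecay.ae_exists_peak hK).mono fun x hx => hx.imp fun i hi => hi.1
  have hA1 : 1 ≤ A := hΦ.one_le (by omega)
  have hlam' : lam = peakGain ν := hlam
  have hlam0 : 0 < lam := hlam' ▸ hν.peakGain_pos hpeak hK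
  have hlam1 : lam ≤ 1 := hlam' ▸ hν.peakGain_le_one hK
  -- the size of the signals
  have hsA : √A * √A = A := Real.mul_self_sqrt (by linarith)
  have hsA1 : 1 ≤ √A := Real.one_le_sqrt.mpr hA1
  have hC1 : 1 ≤ C_L := by
    rw [hC_L]
    nlinarith
  have hC2 : C_L ≤ 9 / 4 * A := by
    rw [hC_L]
    nlinarith
  -- the radius `η` of the neighbourhood
  set η := (N : ℝ) ^ (-q) with hη
  have hη0 : 0 < η := Real.rpow_pos_of_pos hN0 _
  set L := Real.log (4 * A * (K : ℝ) / lam) with hL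
  have hL2 : 207 / 100 ≤ L := le_log_of_eight_le (by
    rw [le_div_iff₀ hlam0]
    nlinarith)
  have hθ : 4 * A * L * η ≤ (1 - 2 * β) ^ 2 := by
    have h1 : 0 ≤ (N : ℝ) ^ (-(2 * q)) / (K : ℝ) := by positivity
    have h2 : η ≤ (1 - 2 * β) ^ 2 / (4 * A * L) := by linarith
    rw [le_div_iff₀ (by positivity)] at h2
    linarith
  have hθ1 : (1 - 2 * β) ^ 2 ≤ 1 := by nlinarith
  have hALη : 4 * A * L * η ≤ 1 := hθ.trans hθ1
  have hAη : 8 * A * η ≤ 1 := by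
    have : 0 < A * η := by positivity
    nlinarith
  have hη8 : 8 * η ≤ 1 := by nlinarith
  have hLη : 4 * L * η ≤ 1 := by
    have : 0 < L * η := by positivity
    nlinarith
  -- In units of `D`, the loss of correlation is at least `9/10` and the bad event costs at most
  -- `3/10`; of the remaining `6/10`, the mesh `δ` of the net uses up `1/10` and the deviation from
  -- the mean `5/10`.
  set D := lam * η ^ 2 / K with hD
  have hD0 : 0 < D := by positivity
  set δ := lam * η ^ 2 / (20 * K * C_L) with hδ
  have hδ0 : 0 < δ := by positivity
  have hδD : 2 * C_L * δ = 1 / 10 * D := by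
    rw [hδ, hD]
    field_simp
    norm_num
  have hym : ∀ n, Measurable (y n) := fun n => by
    rw [show y n = fun ω => synth Φ (fun k => x n ω k) + r n ω from funext (hy n)]
    exact (hsig n).measurable_signal Φ
  have hyindep : iIndepFun y P := by
    have h := hindep.comp (fun _ p => synth Φ (fun k => p.1 k) + p.2) fun _ =>
      ((continuous_synth Φ).measurable.comp measurable_fst).add measurable_snd
    convert h using 1
    exact funext fun n => funext fun ω => hy n ω
  have hyC : ∀ n, ∀ᵐ ω ∂P, ‖y n ω‖ ^ 2 ≤ C_L := fun n => by
    simp only [hy, hC_L]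
    exact (hsig n).ae_norm_signal_sq_le hν hΦ
  have hmean : ∀ Ψ ∈ unitDicts d K, ‖Ψ - Φ‖ = η → ∀ n,
      ∫ ω, (maxResponse Ψ (y n ω) ^ 2 - maxResponse Φ (y n ω) ^ 2) ∂P ≤ -(6 / 10 * D) := by
    intro Ψ hΨ hΨη n
    simp only [hy]
    rw [hD, hlam']
    rw [hlam'] at hL hlam0 hlam1
    exact (hsig n).integral_maxResponse_sub_le_of_norm_sub_eq hν hK hΦ hA1 hβ0 hβ hdecay
      (hC_L ▸ hC2) hlam0 hlam1 hη0 hη8 hL hL2 hLη hθ hΨ hΨη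
  have hmain := measure_not_exists_isLocalMaxOn_le hN hΦu hym hyindep hyC hη0 hδ0
    (t := 5 / 10 * D) (m := 6 / 10 * D) (by positivity) (by rw [hδD]; linarith) hmean
  refine (measure_mono fun ω hω => ?_).trans (hmain.trans (ENNReal.ofReal_le_ofReal ?_))
  · rintro ⟨Ψ, hΨ, hmax, hdist⟩
    exact hω ⟨Ψ, hΨ, hmax, isKSVDLocalMin_of_isLocalMaxOn (by omega) hN hΨ hmax, fun k =>
      ((norm_le_pi_norm (Ψ - Φ) k).trans hdist).trans (by linarith)⟩
  exact net_card_mul_exp_le hN hK2 hlam0 hlam1 hA1 hC1 hC2 hq1 hη hAη
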